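/- **Setting.** A *generalized topology* on a set $X$ consists of a set of subsets of $X$ (the *open* sets) and a set of families of open sets (the *admissible coverings*; a family $(U_i)$ with union $U$ is an admissible covering of $U$) such that: $\emptyset$ and $X$ are open; finite unions and finite intersections of open sets are open; every finite family of open sets is admissible; the union of an admissible family is open; if $(U_i)$ is an admissible covering of $U$ and $V\subseteq U$ is open, then $(V\cap U_i)$ is an admissible covering of $V$; admissible coverings of the members of an admissible covering of $U$ together form an admissible covering of $U$; a family of open sets whose union $U$ is open and which is refined by an admissible covering of $U$ is an admissible covering of $U$; and if $(U_i)$ is an admissible covering of $U$ and $V\subseteq U$ is such that all $U_i\cap V$ are open, then $V$ is open. Sheaves and sheaf cohomology on $X$ are taken with respect to open sets and admissible coverings. Let $k$ be a field of characteristic $0$, let $D$ be a finite-dimensional unital associative $k$-algebra, let $\varepsilon_0:D\to k$ be a $k$-algebra homomorphism, and assume that $J=\ker\varepsilon_0$ is nilpotent. Let $X$ be a set with a generalized topology and $\mathcal C$ a sheaf of commutative $k$-algebras on $X$ whose stalks at the points of $X$ are local rings. A *ringed $D$-space structure* on $X$ is a sheaf $\mathcal A$ of (not necessarily commutative) $k$-algebras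 with a map $\varepsilon:\mathcal A\to\mathcal C$ of sheaves of $k$-algebras for which there are an admissible covering $(U_i)$ of $X$ and isomorphisms of sheaves of $k$-algebras $\tau_i:\mathcal A|_{U_i}\to(\mathcal C\otimes_k D)|_{U_i}$ with $(\mathrm{id}\otimes\varepsilon_0)\circ\tau_i=\varepsilon|_{U_i}$. Let $Z(\mathcal A)$ be the centre of $\mathcal A$ (the sheaf of those sections all of whose restrictions are central) and $\mathcal I_0=\ker\varepsilon\cap Z(\mathcal A)$. For $p\ge 1$ the sheaf $\mathcal I_0^p/\mathcal I_0^{p+1}$ is a sheaf of modules over $Z(\mathcal A)/\mathcal I_0\cong\mathcal C$. Let $\mathrm{Der}(\mathcal C,\mathcal I_0^p/\mathcal I_0^{p+1})$ be the sheaf associated with the presheaf which takes $U$ to the group of $k$-linear derivations of $\mathcal C|_U$ into $(\mathcal I_0^p/\mathcal I_0^{p+1})|_U$. **Theorem.** Let $\varepsilon:\mathcal A\to\mathcal C$ be a ringed $D$-space structure on $X$ such that $$H^1\bigl(X,\mathrm{Der}(\mathcal C,\mathcal I_0^p/\mathcal I_0^{p+1})\bigr)=0\qquad\text{for every integer } p\ge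 1 .$$ Then there is a map $\varphi:\mathcal C\to Z(\mathcal A)$ of sheaves of $k$-algebras with $\varepsilon\circ\varphi=\mathrm{id}_{\mathcal C}$. Moreover, for every such $\varphi$, the sheaf $\mathcal A$, regarded as a sheaf of $\mathcal C$-modules by $c\cdot a=\varphi(c)a$, is a vector bundle over $X$ of class $\mathcal C$ with structure group in $\mathrm{Aut}(D,\varepsilon_0)$: there are an admissible covering $(X_\alpha)$ of $X$ and isomorphisms $\sigma_\alpha:\mathcal A|_{X_\alpha}\to\mathcal C|_{X_\alpha}\otimes_k D$ of sheaves of $\mathcal C$-modules such that every transition function $\sigma_\alpha\circ\sigma_\beta^{-1}$ over $X_\alpha\cap X_\beta$ is an automorphism of the sheaf of $\mathcal C$-algebras $\mathcal C\otimes_k D$ that preserves $\mathrm{id}\otimes\varepsilon_0$. The $\sigma_\alpha$ can be chosen to be isomorphisms of sheaves of algebras with $(\mathrm{id}\otimes\varepsilon_0)\circ\sigma_\alpha=\varepsilon|_{X_\alpha}$. -/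

import Mathlib

open CategoryTheory Opposite
open scoped TensorProduct

universe u

/-- A generalized topology on a set `X`: a set of open subsets together with a set of admissible
coverings.  A family of open sets enters as the set of its members: the axioms `cov_finite`,
`cov_trans` and `cov_refine` show that admissibility of a family depends only on its range. -/
structure GeneralizedTopology (X : Type u) where
  /-- the open subsets -/
  IsOpen : Set X → Prop
  /-- the admissible coverings -/
  IsCov : Set (Set X) → Prop
  isOpen_empty : IsOpen ∅
  isOpen_univ : IsOpen Set.univ
  isOpen_union : ∀ U V, IsOpen U → IsOpen V → IsOpen (U ∪ V)
  isOpen_inter : ∀ U V, IsOpen U → IsOpen V → IsOpen (U ∩ V)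
  isOpen_of_mem_cov : ∀ 𝒰, IsCov 𝒰 → ∀ U ∈ 𝒰, IsOpen U
  cov_finite : ∀ 𝒰 : Set (Set X), 𝒰.Finite → (∀ U ∈ 𝒰, IsOpen U) → IsCov 𝒰
  isOpen_sUnion : ∀ 𝒰, IsCov 𝒰 → IsOpen (⋃₀ 𝒰)
  /-- the trace on an open subset `V` of the union `U` of an admissible covering -/
  cov_inter : ∀ 𝒰, IsCov 𝒰 → ∀ V, IsOpen V → V ⊆ ⋃₀ 𝒰 → IsCov ((fun U => V ∩ U) '' 𝒰)
  /-- admissible coverings of the members of an admissible covering compose -/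
  cov_trans : ∀ 𝒰, IsCov 𝒰 → ∀ 𝒱 : Set X → Set (Set X),
    (∀ U ∈ 𝒰, IsCov (𝒱 U) ∧ ⋃₀ (𝒱 U) = U) → IsCov (⋃ U ∈ 𝒰, 𝒱 U)
  /-- a family of open sets with open union which has an admissible refinement is admissible -/
  cov_refine : ∀ 𝒰 : Set (Set X), (∀ U ∈ 𝒰, IsOpen U) → IsOpen (⋃₀ 𝒰) →
    ∀ 𝒱, IsCov 𝒱 → ⋃₀ 𝒱 = ⋃₀ 𝒰 → (∀ V ∈ 𝒱, ∃ U ∈ 𝒰, V ⊆ U) → IsCov 𝒰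
  /-- openness is local for admissible coverings -/
  isOpen_of_inter : ∀ 𝒰, IsCov 𝒰 → ∀ V ⊆ ⋃₀ 𝒰, (∀ U ∈ 𝒰, IsOpen (U ∩ V)) → IsOpen V

namespace GeneralizedTopology

variable {X : Type u} (T : GeneralizedTopology X)

/-- The ordered set of open subsets, also regarded as a category. -/
def Opens : Type u := {U : Set X // T.IsOpen U}

instance : PartialOrder T.Opens := Subtype.partialOrder _

/-- An admissible covering of the open set `U`. -/
def IsCovOf (U : T.Opens) (𝒰 : Set (Set X)) : Prop := T.IsCov 𝒰 ∧ ⋃₀ 𝒰 = U.1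

/-- The whole space as an open subset. -/
def whole : T.Opens := ⟨Set.univ, T.isOpen_univ⟩

/-- The Grothendieck topology of a generalized topology: a sieve on `U` is covering
if it contains all members of some admissible covering of `U`. -/
def site : GrothendieckTopology T.Opens where
  sieves U := {s | ∃ 𝒰, T.IsCovOf U 𝒰 ∧ ∀ (V : T.Opens) (f : V ⟶ U), V.1 ∈ 𝒰 → s.arrows f}
  top_mem' U := ⟨{U.1}, ⟨T.cov_finite _ (Set.finite_singleton _)
    (fun V hV => by rw [Set.mem_singleton_iff.1 hV]; exact U.2), Set.sUnion_singleton _⟩,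
    fun _ _ _ => trivial⟩
  pullback_stable' := by
    rintro U W s f ⟨𝒰, ⟨h1, h2⟩, h3⟩
    have hWU : W.1 ⊆ U.1 := leOfHom f
    refine ⟨(fun V => W.1 ∩ V) '' 𝒰, ⟨T.cov_inter _ h1 _ W.2 (h2 ▸ hWU), ?_⟩, ?_⟩
    · rw [Set.sUnion_image, ← Set.inter_iUnion₂, ← Set.sUnion_eq_biUnion, h2]
      exact Set.inter_eq_left.2 hWU
    · rintro V g ⟨V', hV', hV⟩
      have hV'o := T.isOpen_of_mem_cov _ h1 _ hV'
      have hV'U : V' ⊆ U.1 := h2 ▸ Set.subset_sUnion_of_mem hV'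
      have hVV' : V ≤ ⟨V', hV'o⟩ := by
        change V.1 ⊆ V'
        rw [← hV]
        exact Set.inter_subset_right
      have := s.downward_closed (h3 ⟨V', hV'o⟩ (homOfLE hV'U) hV') (homOfLE hVV')
      exact this
  transitive' := by
    rintro U s ⟨𝒰, ⟨h1, h2⟩, h3⟩ r hr
    have key : ∀ V ∈ 𝒰, ∃ 𝒱, (T.IsCov 𝒱 ∧ ⋃₀ 𝒱 = V) ∧
        ∀ (W : T.Opens) (f : W ⟶ U), W.1 ∈ 𝒱 → r.arrows f := by
      intro V hV
      have hVU : V ⊆ U.1 := h2 ▸ Set.subset_sUnion_of_mem hV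
      obtain ⟨𝒱, h4, h5⟩ := hr (h3 ⟨V, T.isOpen_of_mem_cov _ h1 _ hV⟩ (homOfLE hVU) hV)
      refine ⟨𝒱, h4, fun W f hW => ?_⟩
      have h6 : ⋃₀ 𝒱 = V := h4.2
      have hWV : W.1 ⊆ V := h6 ▸ Set.subset_sUnion_of_mem hW
      exact h5 W (homOfLE hWV) hW
    choose! 𝒱 h4 h5 using key
    refine ⟨⋃ V ∈ 𝒰, 𝒱 V, ⟨T.cov_trans _ h1 _ h4, ?_⟩, ?_⟩
    · rw [← h2, Set.sUnion_eq_biUnion (s := 𝒰)]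
      ext x
      simp only [Set.mem_sUnion, Set.mem_iUnion, exists_prop]
      constructor
      · rintro ⟨W, ⟨V, hV, hW⟩, hx⟩
        exact ⟨V, hV, (h4 V hV).2 ▸ Set.mem_sUnion_of_mem hx hW⟩
      · rintro ⟨V, hV, hx⟩
        rw [← (h4 V hV).2] at hx
        obtain ⟨W, hW, hx⟩ := hx
        exact ⟨W, ⟨V, hV, hW⟩, hx⟩
    · intro W f hW
      obtain ⟨V, hV, hW⟩ := Set.mem_iUnion₂.1 hW
      exact h5 V hV W f hW

end GeneralizedTopology

section Graded

variable {R : Type u} [CommRing R]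

/-- The quotient `I ^ p / I ^ (p + 1)` (the submodule `I • ⊤` of `I ^ p` is `I ^ (p + 1)`);
it is a module over `R ⧸ I`. -/
abbrev IdealGr (I : Ideal R) (p : ℕ) : Type u := ↥(I ^ p) ⧸ (I • ⊤ : Submodule R ↥(I ^ p))

variable {R' : Type u} [CommRing R']

/-- The map `I ^ p / I ^ (p + 1) → I' ^ p / I' ^ (p + 1)` induced by a ring homomorphism
which maps `I` into `I'`. -/
def IdealGr.map {I : Ideal R} {I' : Ideal R'} (f : R →+* R') (h : I ≤ I'.comap f) (p : ℕ) :
    IdealGr I p →+ IdealGr I' p :=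
  QuotientAddGroup.map _ _
    (((f.toAddMonoidHom.comp (I ^ p).toAddSubgroup.subtype).codRestrict (I' ^ p).toAddSubgroup
      fun x => (Ideal.pow_right_mono (Ideal.map_le_iff_le_comap.2 h) p)
        (Ideal.map_pow f I p ▸ Ideal.mem_map_of_mem f x.2)))
    (by
      rintro x hx
      have hx : x ∈ (I • ⊤ : Submodule R ↥(I ^ p)) := hx
      rw [AddSubgroup.mem_comap]
      rw [Submodule.mem_smul_top_iff] at hx
      change _ ∈ (I' • ⊤ : Submodule R' ↥(I' ^ p))
      rw [Submodule.mem_smul_top_iff]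
      rw [smul_eq_mul, ← pow_succ'] at hx ⊢
      exact (Ideal.pow_right_mono (Ideal.map_le_iff_le_comap.2 h) (p + 1))
        (Ideal.map_pow f I (p + 1) ▸ Ideal.mem_map_of_mem f hx))

lemma IdealGr.map_mk {I : Ideal R} {I' : Ideal R'} (f : R →+* R') (h : I ≤ I'.comap f) (p : ℕ)
    (x : ↥(I ^ p)) (y : ↥(I' ^ p)) (hxy : f x.1 = y.1) :
    IdealGr.map f h p (Submodule.Quotient.mk x) = Submodule.Quotient.mk y :=
  congrArg (Submodule.Quotient.mk (p := (I' • ⊤ : Submodule R' ↥(I' ^ p)))) (Subtype.ext hxy)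

lemma IdealGr.exists_map_mk {I : Ideal R} {I' : Ideal R'} (f : R →+* R') (h : I ≤ I'.comap f)
    (p : ℕ) (x : ↥(I ^ p)) : ∃ y : ↥(I' ^ p), f x.1 = y.1 ∧
      IdealGr.map f h p (Submodule.Quotient.mk x) = Submodule.Quotient.mk y :=
  ⟨⟨f x.1, (Ideal.pow_right_mono (Ideal.map_le_iff_le_comap.2 h) p)
    (Ideal.map_pow f I p ▸ Ideal.mem_map_of_mem f x.2)⟩, rfl, rfl⟩

lemma IdealGr.map_id {I : Ideal R} (f : R →+* R) (h : I ≤ I.comap f) (p : ℕ)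
    (hf : ∀ x, f x = x) (x : IdealGr I p) : IdealGr.map f h p x = x := by
  obtain ⟨x, rfl⟩ := Submodule.Quotient.mk_surjective _ x
  exact IdealGr.map_mk f h p x x (hf x.1)

lemma IdealGr.map_comp {R'' : Type u} [CommRing R''] {I : Ideal R} {I' : Ideal R'}
    {I'' : Ideal R''} (f : R →+* R') (g : R' →+* R'') (e : R →+* R'') (h : I ≤ I'.comap f)
    (h' : I' ≤ I''.comap g) (h'' : I ≤ I''.comap e) (p : ℕ) (he : ∀ x, e x = g (f x))
    (x : IdealGr I p) : IdealGr.map e h'' p x = IdealGr.map g h' p (IdealGr.map f h p x) := by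
  obtain ⟨x, rfl⟩ := Submodule.Quotient.mk_surjective _ x
  obtain ⟨y, hy, hy'⟩ := IdealGr.exists_map_mk f h p x
  obtain ⟨z, hz, hz'⟩ := IdealGr.exists_map_mk g h' p y
  rw [hy', hz']
  exact IdealGr.map_mk e h'' p x z (by rw [he, hy, hz])

lemma IdealGr.map_smul {I : Ideal R} {I' : Ideal R'} (f : R →+* R') (h : I ≤ I'.comap f) (p : ℕ)
    (r : R ⧸ I) (x : IdealGr I p) :
    IdealGr.map f h p (r • x) = Ideal.quotientMap I' f h r • IdealGr.map f h p x := by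
  obtain ⟨r, rfl⟩ := Ideal.Quotient.mk_surjective r
  obtain ⟨x, rfl⟩ := Submodule.Quotient.mk_surjective _ x
  obtain ⟨y, hy, hy'⟩ := IdealGr.exists_map_mk f h p x
  rw [hy']
  refine IdealGr.map_mk f h p (r • x) (f r • y) ?_
  change f (r * x.1) = f r * y.1
  rw [map_mul, hy]

end Graded

section Sheaves

variable {X : Type u} {T : GeneralizedTopology X} {k : Type u} [Field k]

namespace GeneralizedTopology

/-- The stalk at `x` of a sheaf of commutative algebras, as a ring: the colimit of the sections
over the open neighbourhoods of `x`. -/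
noncomputable def stalk (C : Sheaf T.site (CommAlgCat.{u} k)) (x : X) : CommRingCat.{u} :=
  Limits.colimit ((ObjectProperty.ι (fun U : T.Opens => x ∈ U.1)).op ⋙ C.obj ⋙
    forget₂ (CommAlgCat.{u} k) CommRingCat.{u})

/-- All stalks are local rings. -/
def IsLocallyRinged (C : Sheaf T.site (CommAlgCat.{u} k)) : Prop :=
  ∀ x : X, IsLocalRing (stalk C x)

end GeneralizedTopology

/-- The forgetful functor from commutative algebras is corepresented by the polynomial ring. -/
noncomputable def CommAlgCat.coyonedaPolynomialIso :
    coyoneda.obj (op (CommAlgCat.of k (Polynomial k))) ≅ forget (CommAlgCat.{u} k) :=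
  NatIso.ofComponents
    (fun B => Equiv.toIso
      { toFun := fun f => f.hom Polynomial.X
        invFun := fun b => CommAlgCat.ofHom (Polynomial.aeval b)
        left_inv := fun f => by
          apply CommAlgCat.hom_ext
          apply Polynomial.algHom_ext
          simp
        right_inv := fun b => by simp })
    (fun f => by ext g; rfl)

instance : Limits.PreservesLimits (forget (CommAlgCat.{u} k)) :=
  Limits.preservesLimits_of_natIso CommAlgCat.coyonedaPolynomialIso

/-- The sheaf of rings underlying a sheaf of commutative algebras. -/
noncomputable def ringSheaf (C : Sheaf T.site (CommAlgCat.{u} k)) : Sheaf T.site RingCat.{u} where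
  obj := C.obj ⋙ forget₂ (CommAlgCat.{u} k) CommRingCat.{u} ⋙ forget₂ CommRingCat.{u} RingCat.{u}
  property := (Presheaf.isSheaf_iff_isSheaf_forget T.site _ (forget RingCat.{u})).2
    (Presheaf.isSheaf_comp_of_isSheaf T.site C.obj (forget (CommAlgCat.{u} k)) C.property)

/-- A sheaf of commutative algebras regarded as a sheaf of algebras. -/
noncomputable def algSheaf (C : Sheaf T.site (CommAlgCat.{u} k)) : Sheaf T.site (AlgCat.{u} k) where
  obj := C.obj ⋙ forget₂ (CommAlgCat.{u} k) (AlgCat.{u} k)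
  property := (Presheaf.isSheaf_iff_isSheaf_forget T.site _ (forget (AlgCat.{u} k))).2
    (Presheaf.isSheaf_comp_of_isSheaf T.site C.obj (forget (CommAlgCat.{u} k)) C.property)

section Center

variable (A : Sheaf T.site (AlgCat.{u} k))

/-- The sections over `U` of the centre `Z(A)` of a sheaf of algebras `A`: the sections all of
whose restrictions are central. -/
def centerSections (U : T.Opensᵒᵖ) : Subalgebra k (A.obj.obj U) :=
  ⨅ (V : T.Opensᵒᵖ) (f : U ⟶ V), (Subalgebra.center k (A.obj.obj V)).comap (A.obj.map f).hom

variable {A}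

lemma mem_centerSections {U : T.Opensᵒᵖ} {a : A.obj.obj U} :
    a ∈ centerSections A U ↔ ∀ (V : T.Opensᵒᵖ) (f : U ⟶ V),
      (A.obj.map f).hom a ∈ Subalgebra.center k (A.obj.obj V) := by
  simp only [centerSections, Algebra.mem_iInf]
  rfl

lemma map_mem_centerSections {U V : T.Opensᵒᵖ} (f : U ⟶ V)
    {a : A.obj.obj U} (ha : a ∈ centerSections A U) :
    (A.obj.map f).hom a ∈ centerSections A V := by
  rw [mem_centerSections] at ha ⊢
  intro W g
  have := ha W (f ≫ g)
  rw [A.obj.map_comp] at this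
  exact this

instance (U : T.Opensᵒᵖ) : CommRing (centerSections A U) where
  mul_comm a b := by
    have := mem_centerSections.1 a.2 U (𝟙 U)
    rw [A.obj.map_id] at this
    exact Subtype.ext ((Subalgebra.mem_center_iff.1 this b.1).symm)

variable (A)

/-- The presheaf of algebras underlying the centre. -/
def centerPresheaf : T.Opensᵒᵖ ⥤ CommAlgCat.{u} k where
  obj U := CommAlgCat.of k (centerSections A U)
  map {U V} f := CommAlgCat.ofHom
    (((A.obj.map f).hom.comp (centerSections A U).val).codRestrict (centerSections A V)
      fun a => map_mem_centerSections f a.2)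
  map_id U := by
    apply CommAlgCat.hom_ext
    ext a
    simp
  map_comp f g := by
    apply CommAlgCat.hom_ext
    ext a
    simp
    rfl

/-- The centre as a subpresheaf of sets. -/
def centerSubfunctor : Subfunctor (A.obj ⋙ forget (AlgCat.{u} k)) where
  obj U := {a : A.obj.obj U | a ∈ centerSections A U}
  map f _ ha := map_mem_centerSections f ha

lemma isSheaf_centerPresheaf : Presheaf.IsSheaf T.site (centerPresheaf A) := by
  rw [Presheaf.isSheaf_iff_isSheaf_forget T.site _ (forget (CommAlgCat.{u} k))]
  change Presheaf.IsSheaf T.site (centerSubfunctor A).toFunctor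
  have hA := Presheaf.isSheaf_comp_of_isSheaf T.site A.obj (forget (AlgCat.{u} k)) A.property
  rw [isSheaf_iff_isSheaf_of_type] at hA ⊢
  rw [Subfunctor.isSheaf_iff _ hA]
  intro U s hs
  change A.obj.obj U at s
  change s ∈ centerSections A U
  rw [mem_centerSections]
  intro V f
  rw [Subalgebra.mem_center_iff]
  intro b
  have hs' := T.site.pullback_stable f.unop hs
  refine (hA _ hs').isSeparatedFor.ext ?_
  intro W g hg
  have hg : (A.obj.map (f ≫ g.op)).hom s ∈ centerSections A (op W) := hg
  have hc := mem_centerSections.1 hg _ (𝟙 _)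
  rw [A.obj.map_id, A.obj.map_comp] at hc
  have := Subalgebra.mem_center_iff.1 hc ((A.obj.map g.op).hom b)
  change (A.obj.map g.op).hom (b * (A.obj.map f).hom s) =
    (A.obj.map g.op).hom ((A.obj.map f).hom s * b)
  rw [map_mul, map_mul]
  exact this

/-- The centre `Z(A)` of a sheaf of algebras, as a sheaf of commutative algebras. -/
def centerSheaf : Sheaf T.site (CommAlgCat.{u} k) where
  obj := centerPresheaf A
  property := isSheaf_centerPresheaf A

end Center

section Augmented

variable {A : Sheaf T.site (AlgCat.{u} k)} {C : Sheaf T.site (CommAlgCat.{u} k)}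

/-- The restriction `Z(A) → C` of a map of sheaves of algebras `ε : A → C` to the centre. -/
noncomputable def centerAug (ε : A ⟶ algSheaf C) : centerSheaf A ⟶ C where
  hom :=
    { app := fun U => CommAlgCat.ofHom ((ε.hom.app U).hom.comp (centerSections A U).val)
      naturality := fun U V f => by
        apply CommAlgCat.hom_ext
        ext a
        exact congr($(ε.hom.naturality f) a.1) }

/-- The map `id ⊗ ε₀ : B ⊗ D → B`. -/
noncomputable def idTensor {D : Type u} [Ring D] [Algebra k D] (ε₀ : D →ₐ[k] k)
    (B : Type u) [CommRing B] [Algebra k B] : B ⊗[k] D →ₐ[B] B :=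
  (Algebra.TensorProduct.rid k B B).toAlgHom.comp
    (Algebra.TensorProduct.map (AlgHom.id B B) ε₀)

/-- The restriction map `C(U) ⊗ D → C(V) ⊗ D` of the sheaf `C ⊗ D`. -/
noncomputable def tensorRes (C : Sheaf T.site (CommAlgCat.{u} k)) (D : Type u) [Ring D]
    [Algebra k D] {U V : T.Opensᵒᵖ} (f : U ⟶ V) :
    C.obj.obj U ⊗[k] D →ₐ[k] C.obj.obj V ⊗[k] D :=
  Algebra.TensorProduct.map (C.obj.map f).hom (AlgHom.id k D)

variable {D : Type u} [Ring D] [Algebra k D]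

/-- An isomorphism of sheaves of `k`-algebras `τ : A|U → (C ⊗ D)|U` over the open set `U`
with `(id ⊗ ε₀) ∘ τ = ε|U`. -/
structure DTrivialization (ε₀ : D →ₐ[k] k) (ε : A ⟶ algSheaf C) (U : T.Opens) where
  τ : ∀ V : T.Opens, V ≤ U → (A.obj.obj (op V) ≃ₐ[k] C.obj.obj (op V) ⊗[k] D)
  naturality : ∀ (V W : T.Opens) (hV : V ≤ U) (hW : W ≤ V) (a : A.obj.obj (op V)),
    τ W (hW.trans hV) ((A.obj.map (homOfLE hW).op).hom a) =
      tensorRes C D (homOfLE hW).op (τ V hV a)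
  aug : ∀ (V : T.Opens) (hV : V ≤ U) (a : A.obj.obj (op V)),
    idTensor ε₀ (C.obj.obj (op V)) (τ V hV a) = (ε.hom.app (op V)).hom a

/-- `ε : A → C` is a ringed `D`-space structure on `X`. -/
def IsRingedDSpace (ε₀ : D →ₐ[k] k) (ε : A ⟶ algSheaf C) : Prop :=
  ∃ 𝒰, T.IsCovOf T.whole 𝒰 ∧
    ∀ U : T.Opens, U.1 ∈ 𝒰 → Nonempty (DTrivialization ε₀ ε U)

/-- The sections over `U` of the ideal sheaf `I₀ = ker ε ∩ Z(A)` of `Z(A)`. -/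
noncomputable def augIdeal (ε : A ⟶ algSheaf C) (U : T.Opensᵒᵖ) : Ideal (centerSections A U) :=
  RingHom.ker ((centerAug ε).hom.app U).hom

lemma augIdeal_le_comap (ε : A ⟶ algSheaf C) {U V : T.Opensᵒᵖ} (f : U ⟶ V) :
    augIdeal ε U ≤ (augIdeal ε V).comap ((centerPresheaf A).map f).hom.toRingHom := by
  intro a ha
  have h := congr(($((centerAug ε).hom.naturality f)) a)
  have ha : ((centerAug ε).hom.app U).hom a = 0 := ha
  change ((centerAug ε).hom.app V).hom (((centerPresheaf A).map f).hom a) = 0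
  refine h.trans ?_
  change (C.obj.map f).hom (((centerAug ε).hom.app U).hom a) = 0
  rw [ha, map_zero]

/-- The presheaf of rings `U ↦ Z(A)(U) / I₀(U)`. -/
noncomputable def quotPresheaf (ε : A ⟶ algSheaf C) : T.Opensᵒᵖ ⥤ RingCat.{u} where
  obj U := RingCat.of (centerSections A U ⧸ augIdeal ε U)
  map {U V} f := RingCat.ofHom (Ideal.quotientMap (augIdeal ε V)
    ((centerPresheaf A).map f).hom.toRingHom (augIdeal_le_comap ε f))
  map_id U := by
    apply RingCat.hom_ext
    refine Ideal.Quotient.ringHom_ext (RingHom.ext fun x => ?_)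
    change Ideal.Quotient.mk _ _ = _
    rw [(centerPresheaf A).map_id]
    rfl
  map_comp f g := by
    apply RingCat.hom_ext
    refine Ideal.Quotient.ringHom_ext (RingHom.ext fun x => ?_)
    change Ideal.Quotient.mk _ _ = _
    rw [(centerPresheaf A).map_comp]
    rfl

/-- The map of presheaves of rings `Z(A) / I₀ → C` induced by `ε`. -/
noncomputable def quotAug (ε : A ⟶ algSheaf C) : quotPresheaf ε ⟶ (ringSheaf C).obj where
  app U := RingCat.ofHom (Ideal.Quotient.lift (augIdeal ε U)
    ((centerAug ε).hom.app U).hom.toRingHom (fun _ h => h))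
  naturality U V f := by
    apply RingCat.hom_ext
    refine Ideal.Quotient.ringHom_ext (RingHom.ext fun x => ?_)
    exact congr(($((centerAug ε).hom.naturality f)) x)

instance (ε : A ⟶ algSheaf C) : Presheaf.IsLocallyInjective T.site (quotAug ε) where
  equalizerSieve_mem {U} x y h := by
    have : x = y := RingHom.lift_injective_of_ker_le_ideal (augIdeal ε U)
      (f := ((centerAug ε).hom.app U).hom.toRingHom) (fun _ h => h) le_rfl h
    subst this
    rw [Presheaf.equalizerSieve_self_eq_top]
    exact T.site.top_mem _

/-- Locally, `ε : Z(A) → C` is surjective. -/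
lemma IsRingedDSpace.isLocallySurjective {ε₀ : D →ₐ[k] k} {ε : A ⟶ algSheaf C}
    (h : IsRingedDSpace ε₀ ε) : Presheaf.IsLocallySurjective T.site (quotAug ε) where
  imageSieve_mem {U} c := by
    obtain ⟨𝒰, hcov, htriv⟩ := h
    let jU : U ⟶ T.whole := homOfLE (Set.subset_univ _)
    let s : Sieve T.whole := Sieve.generate (fun V (_ : V ⟶ T.whole) => V.1 ∈ 𝒰)
    have hs : s ∈ T.site T.whole :=
      ⟨𝒰, hcov, fun V f hV => Sieve.le_generate _ _ _ hV⟩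
    refine T.site.superset_covering ?_ (T.site.pullback_stable jU hs)
    rintro V f ⟨W, i, j, hW, -⟩
    obtain ⟨t⟩ := htriv W hW
    change C.obj.obj (op U) at c
    have hVW : V ≤ W := leOfHom i
    let b : A.obj.obj (op V) := (t.τ V hVW).symm ((C.obj.map f.op).hom c ⊗ₜ 1)
    have hb : t.τ V hVW b = (C.obj.map f.op).hom c ⊗ₜ 1 := AlgEquiv.apply_symm_apply _ _
    have hbc : b ∈ centerSections A (op V) := by
      rw [mem_centerSections]
      intro V' g
      induction V' with | op V' => ?_
      have hV' : V' ≤ V := leOfHom g.unop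
      have hg := t.naturality V V' hVW hV' b
      rw [hb] at hg
      rw [Subalgebra.mem_center_iff]
      intro x
      apply (t.τ V' (hV'.trans hVW)).injective
      change t.τ V' _ (x * (A.obj.map (homOfLE hV').op).hom b) =
        t.τ V' _ ((A.obj.map (homOfLE hV').op).hom b * x)
      rw [map_mul, map_mul, hg]
      generalize t.τ V' _ x = y
      simp only [tensorRes, Algebra.TensorProduct.map_tmul, map_one]
      induction y with
      | zero => simp
      | add y z hy hz => rw [add_mul, mul_add, hy, hz]
      | tmul y z =>
        rw [Algebra.TensorProduct.tmul_mul_tmul, Algebra.TensorProduct.tmul_mul_tmul, mul_comm,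
          one_mul, mul_one]
    refine ⟨Ideal.Quotient.mk _ (⟨b, hbc⟩ : centerSections A (op V)), ?_⟩
    change (ε.hom.app (op V)).hom b = (C.obj.map f.op).hom c
    rw [← t.aug V hVW, hb]
    simp [idTensor]
    rfl

/-- The abelian presheaf `U ↦ I₀(U) ^ p / I₀(U) ^ (p + 1)`. -/
noncomputable def grAbPresheaf (ε : A ⟶ algSheaf C) (p : ℕ) : T.Opensᵒᵖ ⥤ Ab.{u} where
  obj U := AddCommGrpCat.of (IdealGr (augIdeal ε U) p)
  map {U V} f := AddCommGrpCat.ofHom (IdealGr.map ((centerPresheaf A).map f).hom.toRingHom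
    (augIdeal_le_comap ε f) p)
  map_id U := by
    apply AddCommGrpCat.hom_ext
    refine AddMonoidHom.ext fun x => IdealGr.map_id _ (augIdeal_le_comap ε _) p (fun a => ?_) x
    rw [(centerPresheaf A).map_id]
    rfl
  map_comp {U V W} f g := by
    apply AddCommGrpCat.hom_ext
    refine AddMonoidHom.ext fun x => IdealGr.map_comp _ _ _
      (augIdeal_le_comap ε f) (augIdeal_le_comap ε g) (augIdeal_le_comap ε _) p (fun a => ?_) x
    rw [(centerPresheaf A).map_comp]
    rfl

noncomputable instance (ε : A ⟶ algSheaf C) (p : ℕ) (U : T.Opensᵒᵖ) :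
    Module ((quotPresheaf ε).obj U) ((grAbPresheaf ε p).obj U) :=
  inferInstanceAs (Module (centerSections A U ⧸ augIdeal ε U) (IdealGr (augIdeal ε U) p))

/-- The presheaf `U ↦ I₀(U) ^ p / I₀(U) ^ (p + 1)` of modules over `U ↦ Z(A)(U) / I₀(U)`. -/
noncomputable def grPresheaf (ε : A ⟶ algSheaf C) (p : ℕ) :
    PresheafOfModules.{u} (quotPresheaf ε) :=
  PresheafOfModules.ofPresheaf (grAbPresheaf ε p)
    fun _ _ f r m => IdealGr.map_smul _ (augIdeal_le_comap ε f) p r m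

/-- The sheaf of `C`-modules `I₀ ^ p / I₀ ^ (p + 1)`: the sheaf of modules over `Z(A) / I₀ ≅ C`
associated with `U ↦ I₀(U) ^ p / I₀(U) ^ (p + 1)`. -/
noncomputable def grSheaf {ε₀ : D →ₐ[k] k} {ε : A ⟶ algSheaf C} (h : IsRingedDSpace ε₀ ε)
    (p : ℕ) : SheafOfModules.{u} (ringSheaf C) :=
  haveI := h.isLocallySurjective
  (PresheafOfModules.sheafification (quotAug ε)).obj (grPresheaf ε p)

end Augmented

section Modules

variable {C : Sheaf T.site (CommAlgCat.{u} k)}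

/-- The sections over `U` of a sheaf of `C`-modules, as a `C(U)`-module and a `k`-vector space. -/
def modSections (M : SheafOfModules.{u} (ringSheaf C)) (U : T.Opensᵒᵖ) : Type u := M.val.obj U

noncomputable instance (M : SheafOfModules.{u} (ringSheaf C)) (U : T.Opensᵒᵖ) :
    AddCommGroup (modSections M U) :=
  inferInstanceAs (AddCommGroup (M.val.obj U))

noncomputable instance (M : SheafOfModules.{u} (ringSheaf C)) (U : T.Opensᵒᵖ) :
    Module (C.obj.obj U) (modSections M U) :=
  inferInstanceAs (Module ((ringSheaf C).obj.obj U) (M.val.obj U))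

noncomputable instance (M : SheafOfModules.{u} (ringSheaf C)) (U : T.Opensᵒᵖ) :
    Module k (modSections M U) :=
  Module.compHom _ (algebraMap k (C.obj.obj U))

/-- The restriction maps of a sheaf of `C`-modules. -/
noncomputable def modRes (M : SheafOfModules.{u} (ringSheaf C)) {U V : T.Opensᵒᵖ} (f : U ⟶ V) :
    modSections M U →+ modSections M V :=
  (M.val.presheaf.map f).hom

/-- The abelian group of derivations `C|U → M|U`: families of `k`-linear derivations
`C(V) → M(V)`, for `V ≤ U`, which commute with restrictions. -/
noncomputable def derSections (M : SheafOfModules.{u} (ringSheaf C)) (U : T.Opens) :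
    AddSubgroup (∀ V : {V : T.Opens // V ≤ U},
      Derivation k (C.obj.obj (op V.1)) (modSections M (op V.1))) where
  carrier := {δ | ∀ (V W : {V : T.Opens // V ≤ U}) (h : W.1 ≤ V.1) (c : C.obj.obj (op V.1)),
    δ W ((C.obj.map (homOfLE h).op).hom c) = modRes M (homOfLE h).op (δ V c)}
  add_mem' {δ δ'} hδ hδ' V W h c := by
    rw [Pi.add_apply, Pi.add_apply, Derivation.add_apply, Derivation.add_apply, hδ, hδ', map_add]
  zero_mem' V W h c := by
    rw [Pi.zero_apply, Pi.zero_apply, Derivation.zero_apply, Derivation.zero_apply, map_zero]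
  neg_mem' {δ} hδ V W h c := by
    rw [Pi.neg_apply, Pi.neg_apply, Derivation.neg_apply, Derivation.neg_apply, hδ, map_neg]

/-- The presheaf `U ↦ Der(C|U, M|U)`. -/
noncomputable def derPresheaf (M : SheafOfModules.{u} (ringSheaf C)) :
    T.Opensᵒᵖ ⥤ AddCommGrpCat.{u} where
  obj U := AddCommGrpCat.of (derSections M U.unop)
  map f := AddCommGrpCat.ofHom
    { toFun := fun δ => ⟨fun W => δ.1 ⟨W.1, W.2.trans (leOfHom f.unop)⟩,
        fun _ _ h c => δ.2 ⟨_, _⟩ ⟨_, _⟩ h c⟩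
      map_zero' := rfl
      map_add' := fun _ _ => rfl }
  map_id _ := rfl
  map_comp _ _ := rfl

/-- The sheaf `Der(C, M)` of derivations of `C` into the sheaf of `C`-modules `M`: the sheaf
associated with `U ↦ Der(C|U, M|U)`. -/
noncomputable def derSheaf (M : SheafOfModules.{u} (ringSheaf C)) :
    Sheaf T.site AddCommGrpCat.{u} :=
  (presheafToSheaf T.site AddCommGrpCat.{u}).obj (derPresheaf M)

variable (M : SheafOfModules.{u} (ringSheaf C)) (D : Type u) [Ring D] [Algebra k D]

/-- An isomorphism of sheaves of `C`-modules `σ : M|U → C|U ⊗ D` over the open set `U`. -/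
structure ModuleTrivialization (U : T.Opens) where
  σ : ∀ V : T.Opens, V ≤ U →
    (modSections M (op V) ≃ₗ[C.obj.obj (op V)] C.obj.obj (op V) ⊗[k] D)
  naturality : ∀ (V W : T.Opens) (hV : V ≤ U) (hW : W ≤ V) (m : modSections M (op V)),
    σ W (hW.trans hV) (modRes M (homOfLE hW).op m) = tensorRes C D (homOfLE hW).op (σ V hV m)

/-- The structure on `M` of a vector bundle of class `C` over `X` with fibre `D`. -/
structure BundleOfClass where
  /-- an admissible covering of `X` -/
  cover : Set (Set X)
  isCovOf : T.IsCovOf T.whole cover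
  triv : ∀ U : T.Opens, U.1 ∈ cover → ModuleTrivialization M D U

variable {M D}

/-- The transition function `σ_U ∘ σ_U'⁻¹` over an open subset `V` of `U ∩ U'`. -/
noncomputable def BundleOfClass.transition (E : BundleOfClass M D) (U U' : T.Opens)
    (hU : U.1 ∈ E.cover) (hU' : U'.1 ∈ E.cover) (V : T.Opens) (hV : V ≤ U) (hV' : V ≤ U') :
    C.obj.obj (op V) ⊗[k] D ≃ₗ[C.obj.obj (op V)] C.obj.obj (op V) ⊗[k] D :=
  ((E.triv U' hU').σ V hV').symm.trans ((E.triv U hU).σ V hV)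

/-- The `B`-valued points of `Aut(D, ε₀)`: the automorphisms of the `B`-algebra `B ⊗ D` which
preserve `id ⊗ ε₀`, as a subgroup of the `B`-valued points of `GL(D)`. -/
def autAug (ε₀ : D →ₐ[k] k) (B : Type u) [CommRing B] [Algebra k B] :
    Subgroup (B ⊗[k] D ≃ₗ[B] B ⊗[k] D) where
  carrier := {g | g 1 = 1 ∧ (∀ x y, g (x * y) = g x * g y) ∧
    ∀ x, idTensor ε₀ B (g x) = idTensor ε₀ B x}
  mul_mem' {g h} hg hh := by
    refine ⟨?_, fun x y => ?_, fun x => ?_⟩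
    · rw [LinearEquiv.mul_apply, hh.1, hg.1]
    · rw [LinearEquiv.mul_apply, hh.2.1, hg.2.1]; rfl
    · rw [LinearEquiv.mul_apply, hg.2.2, hh.2.2]
  one_mem' := ⟨rfl, fun _ _ => rfl, fun _ => rfl⟩
  inv_mem' {g} hg := by
    refine ⟨?_, fun x y => ?_, fun x => ?_⟩
    · exact g.symm_apply_eq.2 hg.1.symm
    · refine g.symm_apply_eq.2 ?_
      rw [hg.2.1]
      exact congrArg₂ _ (g.apply_symm_apply x).symm (g.apply_symm_apply y).symm
    · refine (hg.2.2 _).symm.trans (congrArg _ (g.apply_symm_apply x))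

/-- The vector bundle has structure group in `Aut(D, ε₀)`: so do all its transition functions. -/
def BundleOfClass.HasStructureGroup (E : BundleOfClass M D) (ε₀ : D →ₐ[k] k) : Prop :=
  ∀ (U U' : T.Opens) (hU : U.1 ∈ E.cover) (hU' : U'.1 ∈ E.cover) (V : T.Opens)
    (hV : V ≤ U) (hV' : V ≤ U'),
    E.transition U U' hU hU' V hV hV' ∈ autAug ε₀ (C.obj.obj (op V))

variable {A : Sheaf T.site (AlgCat.{u} k)}

/-- The abelian presheaf underlying a sheaf of algebras. -/
def abPresheaf (A : Sheaf T.site (AlgCat.{u} k)) : T.Opensᵒᵖ ⥤ Ab.{u} where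
  obj U := AddCommGrpCat.of (A.obj.obj U)
  map f := AddCommGrpCat.ofHom (A.obj.map f).hom.toRingHom.toAddMonoidHom
  map_id U := by rw [A.obj.map_id]; rfl
  map_comp f g := by rw [A.obj.map_comp]; rfl

/-- The action `c • a = φ(c) a` of `C` on `A` given by a map `φ : C → Z(A)`. -/
@[reducible] noncomputable def centralModule (φ : C ⟶ centerSheaf A) (U : T.Opensᵒᵖ) :
    Module ((ringSheaf C).obj.obj U) ((abPresheaf A).obj U) :=
  Module.compHom (A.obj.obj U)
    ((centerSections A U).val.toRingHom.comp (φ.hom.app U).hom.toRingHom)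

/-- The sheaf of `C`-modules `A`, with `C` acting through a map `φ : C → Z(A)` of sheaves of
algebras. -/
noncomputable def moduleOfCentral (φ : C ⟶ centerSheaf A) : SheafOfModules.{u} (ringSheaf C) where
  val :=
    letI := centralModule φ
    PresheafOfModules.ofPresheaf (abPresheaf A) (by
      intro U V f c (a : A.obj.obj U)
      have h : ((φ.hom.app V).hom ((C.obj.map f).hom c)).1 =
          (A.obj.map f).hom ((φ.hom.app U).hom c).1 :=
        congrArg Subtype.val (congr(($(φ.hom.naturality f)) c))
      change (A.obj.map f).hom (((φ.hom.app U).hom c).1 * a) =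
        ((φ.hom.app V).hom ((C.obj.map f).hom c)).1 * (A.obj.map f).hom a
      rw [map_mul]
      exact congrArg (· * (A.obj.map f).hom a) h.symm)
  isSheaf := by
    rw [Presheaf.isSheaf_iff_isSheaf_forget T.site _ (forget Ab.{u})]
    exact Presheaf.isSheaf_comp_of_isSheaf T.site A.obj (forget (AlgCat.{u} k)) A.property

/-- The sections of `moduleOfCentral φ` over `U` are those of `A`. -/
def toModuleOfCentral (φ : C ⟶ centerSheaf A) (U : T.Opensᵒᵖ) :
    A.obj.obj U ≃ modSections (moduleOfCentral φ) U :=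
  Equiv.refl _

/-- The local trivializations are isomorphisms of sheaves of algebras and identify `ε` with
`id ⊗ ε₀`. -/
def BundleOfClass.IsCompatible {φ : C ⟶ centerSheaf A} (E : BundleOfClass (moduleOfCentral φ) D)
    (ε₀ : D →ₐ[k] k) (ε : A ⟶ algSheaf C) : Prop :=
  ∀ (U : T.Opens) (hU : U.1 ∈ E.cover) (V : T.Opens) (hV : V ≤ U),
    (∀ a b : A.obj.obj (op V),
      (E.triv U hU).σ V hV (toModuleOfCentral φ _ (a * b)) =
        (E.triv U hU).σ V hV (toModuleOfCentral φ _ a) *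
          (E.triv U hU).σ V hV (toModuleOfCentral φ _ b)) ∧
    ∀ a : A.obj.obj (op V),
      idTensor ε₀ (C.obj.obj (op V)) ((E.triv U hU).σ V hV (toModuleOfCentral φ _ a)) =
        (ε.hom.app (op V)).hom a

end Modules

end Sheaves

/-! A trivialization over `U` yields a section `c ↦ τ⁻¹(c ⊗ 1)` of `ε : Z(A) → C` over `U`
(`DTrivialization.scalar`), and `φ` exists as soon as the trivializations can be chosen so that
these sections agree on overlaps. They are made to agree modulo higher and higher powers of `I₀`;
nilpotency of `J` ends the process.

Suppose that they agree modulo `I₀ ^ p`, with `p ≥ 1`. Modulo `I₀ ^ (p + 1)` the difference of two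
of them is a derivation of `C` into `I₀ ^ p / I₀ ^ (p + 1)` (`diffDer`), and these differences form
a 1-cocycle. As `H¹` vanishes, it is the coboundary of derivations `d_U`
(`exists_derivation_coboundary`). Over `U`, `d_U` lifts to a derivation `δ` of `C` into the centre
of `C ⊗ D`. The `D`-linear extension of `δ` is a nilpotent derivation of the algebra `C ⊗ D`, so in
characteristic zero its exponential is an automorphism. Composing the trivialization with it changes
the section by `-d_U` modulo `I₀ ^ (p + 1)` (`τ_scalar_compExp`), so the new sections agree to one
order more (`exists_agreeModPow_succ`).

The local computations rest on one description: in a trivialization, `I₀ ^ p` is `C ⊗ S_p`, where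
`S_p` is the `p`th power of the ideal `Z(D) ∩ ker ε₀` of `Z(D)` (`mem_augIdeal_pow_iff`). Since
`S_(p+1)` has a linear complement in `S_p`, the quotient splits `C`-linearly. Hence the presheaf `I₀
^ p / I₀ ^ (p + 1)` already satisfies the sheaf condition over trivializing open sets, and
sheafification changes nothing there.

Now let `φ` be any section. In a trivialization `φ(c)` differs from `c ⊗ 1` by an element of `C ⊗
S_1`, so `c ⊗ d ↦ φ(c) (1 ⊗ d)` is the identity plus a nilpotent map and therefore an automorphism
of algebras. Composing `τ` with its inverse gives a trivialization which takes `φ(c)` to `c ⊗ 1`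
(`ofCentral`), that is, a `C`-linear one. Transition functions between such trivializations are
automorphisms of `C`-algebras preserving the augmentation. -/

section BaseChange

/-! ### Subspaces of `R ⊗ D` of the form `R ⊗ S` -/

variable {k : Type u} [Field k]

/-- Membership in a base-changed subspace can be checked by induction. -/
lemma Submodule.baseChange_induction {R M : Type u} [CommRing R] [Algebra k R] [AddCommGroup M]
    [Module k M] {S : Submodule k M} {P : R ⊗[k] M → Prop}
    (zero : P 0) (add : ∀ x y, P x → P y → P (x + y)) (tmul : ∀ r, ∀ s ∈ S, P (r ⊗ₜ s))
    {x : R ⊗[k] M} (hx : x ∈ S.baseChange R) : P x := by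
  rw [Submodule.baseChange_eq_span] at hx
  refine Submodule.closure_induction (p := fun x _ => P x) zero
    (fun x y _ _ => add x y) (fun r x hx => ?_) hx
  obtain ⟨s, hs, rfl⟩ := hx
  simpa [TensorProduct.smul_tmul'] using tmul r s hs

lemma Submodule.baseChange_le_baseChange {R M : Type u} [CommRing R] [Algebra k R]
    [AddCommGroup M] [Module k M] {S S' : Submodule k M} (h : S ≤ S') :
    S.baseChange R ≤ S'.baseChange R := fun _ hx =>
  Submodule.baseChange_induction (zero_mem _) (fun _ _ => add_mem)
    (fun r _ hs => Submodule.tmul_mem_baseChange_of_mem r (h hs)) hx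

lemma LinearMap.baseChange_mem_baseChange {R M N : Type u} [CommRing R] [Algebra k R]
    [AddCommGroup M] [Module k M] [AddCommGroup N] [Module k N] (f : M →ₗ[k] N)
    {S : Submodule k M} {S' : Submodule k N} (h : ∀ s ∈ S, f s ∈ S')
    {x : R ⊗[k] M} (hx : x ∈ S.baseChange R) : f.baseChange R x ∈ S'.baseChange R := by
  refine Submodule.baseChange_induction (P := fun x => f.baseChange R x ∈ S'.baseChange R)
    ?_ (fun x y hx hy => ?_) (fun r s hs => ?_) hx
  · rw [map_zero]; exact zero_mem _
  · rw [map_add]; exact add_mem hx hy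
  · rw [LinearMap.baseChange_tmul]; exact Submodule.tmul_mem_baseChange_of_mem r (h s hs)

/-- A linear map which is the identity modulo `S'` on `S` is so after base change. -/
lemma LinearMap.baseChange_sub_mem_baseChange {R M : Type u} [CommRing R] [Algebra k R]
    [AddCommGroup M] [Module k M] (f : M →ₗ[k] M) {S S' : Submodule k M}
    (h : ∀ s ∈ S, f s - s ∈ S') {x : R ⊗[k] M} (hx : x ∈ S.baseChange R) :
    f.baseChange R x - x ∈ S'.baseChange R := by
  have := (f - LinearMap.id).baseChange_mem_baseChange (R := R) (S' := S') h hx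
  rwa [LinearMap.baseChange_sub, LinearMap.baseChange_id] at this

lemma Submodule.mem_baseChange_top {R M : Type u} [CommRing R] [Algebra k R] [AddCommGroup M]
    [Module k M] (x : R ⊗[k] M) : x ∈ (⊤ : Submodule k M).baseChange R := by
  rw [Submodule.baseChange_top]; trivial

variable {D R : Type u} [Ring D] [Algebra k D] [CommRing R] [Algebra k R]

lemma Submodule.mul_mem_baseChange {S S' S'' : Submodule k D}
    (h : ∀ s ∈ S, ∀ s' ∈ S', s * s' ∈ S'') {x y : R ⊗[k] D}
    (hx : x ∈ S.baseChange R) (hy : y ∈ S'.baseChange R) : x * y ∈ S''.baseChange R := by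
  refine Submodule.baseChange_induction (P := fun x => x * y ∈ S''.baseChange R)
    ?_ (fun x x' hx hx' => ?_) (fun r s hs => ?_) hx
  · rw [zero_mul]; exact zero_mem _
  · rw [add_mul]; exact add_mem hx hx'
  refine Submodule.baseChange_induction (P := fun y => (r ⊗ₜ s) * y ∈ S''.baseChange R)
    ?_ (fun x x' hx hx' => ?_) (fun r s hs => ?_) hy
  · rw [mul_zero]; exact zero_mem _
  · rw [mul_add]; exact add_mem hx hx'
  · rw [Algebra.TensorProduct.tmul_mul_tmul]
    exact Submodule.tmul_mem_baseChange_of_mem _ (h _ ‹_› _ hs)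

/-- The base change of a map fixing `D` maps `S ⊗ R` into `S ⊗ R'`. -/
lemma Algebra.TensorProduct.map_id_mem_baseChange {R' : Type u} [CommRing R'] [Algebra k R']
    (f : R →ₐ[k] R') {S : Submodule k D} {x : R ⊗[k] D} (hx : x ∈ S.baseChange R) :
    Algebra.TensorProduct.map f (AlgHom.id k D) x ∈ S.baseChange R' := by
  refine Submodule.baseChange_induction
    (P := fun x => Algebra.TensorProduct.map f (AlgHom.id k D) x ∈ S.baseChange R')
    ?_ (fun x y hx hy => ?_) (fun r s hs => ?_) hx
  · rw [map_zero]; exact zero_mem _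
  · rw [map_add]; exact add_mem hx hy
  · exact Submodule.tmul_mem_baseChange_of_mem _ hs

lemma Algebra.TensorProduct.map_id_baseChange {R' : Type u} [CommRing R'] [Algebra k R']
    (f : R →ₐ[k] R') (g : D →ₗ[k] D) (x : R ⊗[k] D) :
    Algebra.TensorProduct.map f (AlgHom.id k D) (g.baseChange R x) =
      g.baseChange R' (Algebra.TensorProduct.map f (AlgHom.id k D) x) := by
  induction x with
  | zero => simp
  | add x y hx hy => simp only [map_add, hx, hy]
  | tmul r d => simp

end BaseChange

/-! ### The filtration of the centre of `D` by powers of `Z(D) ∩ ker ε₀` -/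

section CentralPowers

variable {k D : Type u} [Field k] [Ring D] [Algebra k D] (ε₀ : D →ₐ[k] k)

@[simp]
lemma idTensor_tmul {R : Type u} [CommRing R] [Algebra k R] (r : R) (d : D) :
    idTensor ε₀ R (r ⊗ₜ d) = ε₀ d • r := by
  simp [idTensor]

/-- The image in `D` of the `p`th power of the ideal `Z(D) ∩ ker ε₀` of `Z(D)`. -/
def centralPow (p : ℕ) : Submodule k D :=
  ((RingHom.ker (ε₀.comp (Subalgebra.center k D).val) ^ p).restrictScalars k).map
    (Subalgebra.center k D).val.toLinearMap

variable {ε₀}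

lemma mem_centralPow {p : ℕ} {d : D} : d ∈ centralPow ε₀ p ↔
    ∃ z ∈ RingHom.ker (ε₀.comp (Subalgebra.center k D).val) ^ p, (z : D) = d := by
  simp only [centralPow, Submodule.mem_map]
  rfl

lemma centralPow_le_center {p : ℕ} {d : D} (hd : d ∈ centralPow ε₀ p) :
    d ∈ Subalgebra.center k D := by
  obtain ⟨z, -, rfl⟩ := mem_centralPow.1 hd
  exact z.2

lemma mem_centralPow_zero {d : D} : d ∈ centralPow ε₀ 0 ↔ d ∈ Subalgebra.center k D :=
  ⟨centralPow_le_center, fun h => mem_centralPow.2 ⟨⟨d, h⟩, by simp, rfl⟩⟩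

lemma mem_centralPow_one {d : D} :
    d ∈ centralPow ε₀ 1 ↔ d ∈ Subalgebra.center k D ∧ ε₀ d = 0 := by
  rw [mem_centralPow, pow_one]
  constructor
  · rintro ⟨z, hz, rfl⟩
    exact ⟨z.2, hz⟩
  · rintro ⟨h, h'⟩
    exact ⟨⟨d, h⟩, h', rfl⟩

lemma mul_mem_centralPow {p q : ℕ} {a b : D} (ha : a ∈ centralPow ε₀ p)
    (hb : b ∈ centralPow ε₀ q) : a * b ∈ centralPow ε₀ (p + q) := by
  obtain ⟨y, hy, rfl⟩ := mem_centralPow.1 ha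
  obtain ⟨z, hz, rfl⟩ := mem_centralPow.1 hb
  refine mem_centralPow.2 ⟨y * z, ?_, rfl⟩
  rw [pow_add]
  exact Ideal.mul_mem_mul hy hz

lemma centralPow_anti {p q : ℕ} (h : p ≤ q) : centralPow ε₀ q ≤ centralPow ε₀ p := by
  intro d hd
  obtain ⟨z, hz, rfl⟩ := mem_centralPow.1 hd
  exact mem_centralPow.2 ⟨z, Ideal.pow_le_pow_right h hz, rfl⟩

lemma centralPow_le_ker {p : ℕ} {d : D} (hd : d ∈ centralPow ε₀ p) :
    d ∈ (RingHom.ker ε₀) ^ p := by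
  obtain ⟨z, hz, rfl⟩ := mem_centralPow.1 hd
  clear hd
  induction p generalizing z with
  | zero => rw [Submodule.pow_zero, Ideal.one_eq_top]; trivial
  | succ p ih =>
    rw [pow_succ] at hz
    rw [Submodule.pow_succ]
    induction hz using Submodule.mul_induction_on' with
    | mem_mul_mem a ha b hb => exact Ideal.mul_mem_mul (ih a ha) hb
    | add x _ y _ hx hy => exact add_mem hx hy

/-- The `p`th power of `Z(D) ∩ ker ε₀` lies in the `p`th power of `ker ε₀`. This is what makes the
successive approximation stop. -/
lemma centralPow_eq_bot {N : ℕ} (hN : RingHom.ker ε₀ ^ N = ⊥) : centralPow ε₀ N = ⊥ := by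
  rw [eq_bot_iff]
  intro d hd
  have := centralPow_le_ker hd
  rw [hN] at this
  exact this

/-- A projection of `D` onto a complement of `S_{p + 1}` in `S_p`, where `S_p` is
`centralPow ε₀ p`. -/
lemma exists_centralPow_projection (ε₀ : D →ₐ[k] k) (p : ℕ) : ∃ π : D →ₗ[k] D,
    (∀ d, π d ∈ centralPow ε₀ p) ∧ (∀ d ∈ centralPow ε₀ (p + 1), π d = 0) ∧
      (∀ d ∈ centralPow ε₀ p, π d - d ∈ centralPow ε₀ (p + 1)) ∧ ∀ d, π (π d) = π d := by
  set S := centralPow ε₀ p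
  -- Over a field everything splits: `r` retracts `D` onto `S_p`, and `s` is a section of `S_p → S_p
  -- / S_(p+1)`. The projection is `r`, followed by passage to the quotient and then by `s`.
  obtain ⟨r, hr⟩ := S.subtype.exists_leftInverse_of_injective (by simp)
  let S' : Submodule k S := (centralPow ε₀ (p + 1)).comap S.subtype
  obtain ⟨s, hs⟩ := S'.mkQ.exists_rightInverse_of_surjective (by simp)
  have hr' (x : S) : r x = x := LinearMap.congr_fun hr x
  have hs' (x) : S'.mkQ (s x) = x := LinearMap.congr_fun hs x
  refine ⟨S.subtype ∘ₗ s ∘ₗ S'.mkQ ∘ₗ r, fun d => (s _).2, fun d hd => ?_, fun d hd => ?_,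
    fun d => ?_⟩
  · have hdS : d ∈ S := centralPow_anti p.le_succ hd
    have : S'.mkQ (r d) = 0 := by
      rw [hr' ⟨d, hdS⟩]
      exact (Submodule.Quotient.mk_eq_zero _).2 hd
    simp only [LinearMap.comp_apply, this, map_zero]
  · have : S'.mkQ (s (S'.mkQ (r d)) - ⟨d, hd⟩) = 0 := by
      rw [map_sub, hs', hr' ⟨d, hd⟩, sub_self]
    exact (Submodule.Quotient.mk_eq_zero S').1 this
  · simp only [LinearMap.comp_apply, Submodule.subtype_apply, hr', hs']

variable {R : Type u} [CommRing R] [Algebra k R]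

lemma commute_of_mem_baseChange_centralPow {p : ℕ} {x : R ⊗[k] D}
    (hx : x ∈ (centralPow ε₀ p).baseChange R) (y : R ⊗[k] D) : y * x = x * y := by
  refine Submodule.baseChange_induction (P := fun x => y * x = x * y)
    (by simp) (fun x x' hx hx' => by rw [mul_add, add_mul, hx, hx']) (fun r s hs => ?_) hx
  induction y with
  | zero => simp
  | add x y hx hy => rw [mul_add, add_mul, hx, hy]
  | tmul r' d =>
    rw [Algebra.TensorProduct.tmul_mul_tmul, Algebra.TensorProduct.tmul_mul_tmul, mul_comm,
      Subalgebra.mem_center_iff.1 (centralPow_le_center hs) d]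

/-- The centre of `R ⊗ D` is contained in `R ⊗ Z(D)`. -/
lemma mem_baseChange_centralPow_zero {x : R ⊗[k] D} (h : ∀ y, y * x = x * y) :
    x ∈ (centralPow ε₀ 0).baseChange R := by
  -- It is enough that `x` commutes with `1 ⊗ D`: the centralizer of this subalgebra is already `R ⊗
  -- Z(D)`.
  have hx : x ∈ Subalgebra.centralizer k
      (Algebra.TensorProduct.includeRight : D →ₐ[k] R ⊗[k] D).range := by
    rw [Subalgebra.mem_centralizer_iff]
    exact fun y _ => h y
  rw [Subalgebra.centralizer_range_includeRight_eq_center_tensorProduct] at hx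
  obtain ⟨y, rfl⟩ := hx
  clear h
  change Algebra.TensorProduct.map _ _ y ∈ _
  induction y with
  | zero => rw [map_zero]; exact zero_mem _
  | add x y hx hy => rw [map_add]; exact add_mem hx hy
  | tmul r z => exact Submodule.tmul_mem_baseChange_of_mem _ (mem_centralPow_zero.2 z.2)

/-- The elements of the kernel of `id ⊗ ε₀` in a subspace `R ⊗ S`, where `S` contains `1`. -/
lemma mem_baseChange_of_idTensor_eq_zero {S S' : Submodule k D}
    (h : ∀ d ∈ S, d - algebraMap k D (ε₀ d) ∈ S') {x : R ⊗[k] D} (hx : x ∈ S.baseChange R)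
    (h0 : idTensor ε₀ R x = 0) : x ∈ S'.baseChange R := by
  -- The projection of `D` onto `ker ε₀` along `k · 1`. Its base change fixes `x`, because the
  -- augmentation of `x` is zero.
  let f : D →ₗ[k] D := LinearMap.id - (Algebra.linearMap k D) ∘ₗ ε₀.toLinearMap
  have hf (x : R ⊗[k] D) : f.baseChange R x = x - idTensor ε₀ R x ⊗ₜ 1 := by
    induction x with
    | zero => simp
    | add x y hx hy => rw [map_add, map_add, hx, hy, TensorProduct.add_tmul]; abel
    | tmul r d =>
      simp only [LinearMap.baseChange_tmul, idTensor_tmul]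
      change r ⊗ₜ (d - algebraMap k D (ε₀ d)) = _
      rw [TensorProduct.tmul_sub, Algebra.algebraMap_eq_smul_one, TensorProduct.tmul_smul,
        TensorProduct.smul_tmul']
  have := f.baseChange_mem_baseChange (R := R) (S' := S') h hx
  rwa [hf, h0, TensorProduct.zero_tmul, sub_zero] at this

lemma mem_baseChange_centralPow_one {x : R ⊗[k] D} (h : ∀ y, y * x = x * y)
    (h0 : idTensor ε₀ R x = 0) : x ∈ (centralPow ε₀ 1).baseChange R := by
  refine mem_baseChange_of_idTensor_eq_zero (fun d hd => ?_)
    (mem_baseChange_centralPow_zero (ε₀ := ε₀) h) h0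
  refine mem_centralPow_one.2 ⟨sub_mem (centralPow_le_center hd)
    (Subalgebra.algebraMap_mem _ _), ?_⟩
  rw [map_sub, AlgHom.commutes, Algebra.algebraMap_self, RingHom.id_apply, sub_self]

lemma idTensor_eq_zero_of_mem_baseChange {S : Submodule k D} (hS : ∀ d ∈ S, ε₀ d = 0)
    {x : R ⊗[k] D} (hx : x ∈ S.baseChange R) : idTensor ε₀ R x = 0 :=
  Submodule.baseChange_induction (P := fun x => idTensor ε₀ R x = 0) (map_zero _)
    (fun x y hx hy => by rw [map_add, hx, hy, add_zero])
    (fun r s hs => by rw [idTensor_tmul, hS s hs, zero_smul]) hx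

end CentralPowers

/-! ### The `D`-linear extension of a derivation with central values -/

section TensorDerivation

variable {k : Type u} [Field k]

variable {D R : Type u} [Ring D] [Algebra k D] [CommRing R] [Algebra k R]

/-- The `D`-linear extension `r ⊗ d ↦ δ r * (1 ⊗ d)` of a derivation `δ : R → R ⊗ D`. -/
noncomputable def tensorDer (δ : Derivation k R (R ⊗[k] D)) : Module.End k (R ⊗[k] D) :=
  TensorProduct.lift ((LinearMap.mul k (R ⊗[k] D)).compl₁₂ δ.toLinearMap
    (Algebra.TensorProduct.includeRight (R := k) (A := R) (B := D)).toLinearMap)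

@[simp]
lemma tensorDer_tmul (δ : Derivation k R (R ⊗[k] D)) (r : R) (d : D) :
    tensorDer δ (r ⊗ₜ d) = δ r * (1 ⊗ₜ d) := rfl

variable {ε₀ : D →ₐ[k] k} {δ : Derivation k R (R ⊗[k] D)} {p : ℕ}

/-- The Leibniz rule survives the noncommutativity of `D` because the values of `δ` are central and
can be moved past `1 ⊗ d`. -/
lemma tensorDer_mul (hδ : ∀ r, δ r ∈ (centralPow ε₀ p).baseChange R) (x y : R ⊗[k] D) :
    tensorDer δ (x * y) = x * tensorDer δ y + tensorDer δ x * y := by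
  induction x with
  | zero => simp
  | add x x' hx hx' => rw [add_mul, map_add, hx, hx', map_add]; noncomm_ring
  | tmul r d =>
  induction y with
  | zero => simp
  | add y y' hy hy' => rw [mul_add, map_add, hy, hy', map_add]; noncomm_ring
  | tmul r' d' =>
    have h1 (s : R) (z : R ⊗[k] D) : s • z = (s ⊗ₜ[k] (1 : D)) * z := by
      exact Algebra.smul_def s z
    have h2 (r : R) (d : D) : r ⊗ₜ[k] d = (r ⊗ₜ[k] 1) * (1 ⊗ₜ[k] d) := by simp
    have h3 (s : R) (z : R ⊗[k] D) : (s ⊗ₜ[k] (1 : D)) * z = z * (s ⊗ₜ[k] (1 : D)) :=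
      (Algebra.commutes s z)
    rw [Algebra.TensorProduct.tmul_mul_tmul, tensorDer_tmul, tensorDer_tmul, tensorDer_tmul,
      Derivation.leibniz, h1, h1, h2 r d, h2 r' d']
    have h4 : (1 : R) ⊗ₜ[k] (d * d') = (1 ⊗ₜ d) * (1 ⊗ₜ d') := by simp
    have h5 := commute_of_mem_baseChange_centralPow (hδ r') (1 ⊗ₜ d)
    have h6 := h3 r' (1 ⊗ₜ d)
    rw [h4, add_mul]
    congr 1
    · simp only [mul_assoc]
      rw [← mul_assoc (1 ⊗ₜ d), h5, mul_assoc]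
    · rw [h3 r' (δ r)]
      simp only [mul_assoc]
      rw [← mul_assoc (1 ⊗ₜ d), ← h6, mul_assoc]

/-- The factor `δ r` contributes `p` to the degree in the central filtration. This allows the terms
of order at least two of the exponential to be discarded modulo `S_(p+1)`. -/
lemma tensorDer_mem_of_mem_centralPow (hδ : ∀ r, δ r ∈ (centralPow ε₀ p).baseChange R) {q : ℕ}
    {x : R ⊗[k] D} (hx : x ∈ (centralPow ε₀ q).baseChange R) :
    tensorDer δ x ∈ (centralPow ε₀ (p + q)).baseChange R :=
  Submodule.baseChange_induction
    (P := fun x => tensorDer δ x ∈ (centralPow ε₀ (p + q)).baseChange R)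
    (by rw [map_zero]; exact zero_mem _)
    (fun x y hx hy => by rw [map_add]; exact add_mem hx hy)
    (fun r s hs => Submodule.mul_mem_baseChange (fun _ ha _ hb => mul_mem_centralPow ha hb) (hδ r)
      (Submodule.tmul_mem_baseChange_of_mem _ hs)) hx

/-- The `k`-subspace of `D` underlying a power of the augmentation ideal. -/
def augPow (ε₀ : D →ₐ[k] k) (q : ℕ) : Submodule k D :=
  (RingHom.ker ε₀ ^ q).restrictScalars k

/-- Nilpotency on all of `R ⊗ D` cannot be read off from the central filtration, which starts with
`Z(D)` only. The powers of `ker ε₀` start with `D` itself, and `δ r` raises their degree because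
`S_p` lies in `ker ε₀` for `p ≥ 1`. -/
lemma tensorDer_mem_of_mem_augPow (hp : 1 ≤ p) (hδ : ∀ r, δ r ∈ (centralPow ε₀ p).baseChange R)
    {q : ℕ} {x : R ⊗[k] D} (hx : x ∈ (augPow ε₀ q).baseChange R) :
    tensorDer δ x ∈ (augPow ε₀ (q + 1)).baseChange R := by
  refine Submodule.baseChange_induction
    (P := fun x => tensorDer δ x ∈ (augPow ε₀ (q + 1)).baseChange R)
    (by rw [map_zero]; exact zero_mem _)
    (fun x y hx hy => by rw [map_add]; exact add_mem hx hy) (fun r s hs => ?_) hx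
  -- The central factor `δ r` goes to the right, to match the form `J ^ q * J` of `J ^ (q + 1)`.
  rw [tensorDer_tmul, ← commute_of_mem_baseChange_centralPow (hδ r)]
  refine Submodule.mul_mem_baseChange (fun a ha b hb => ?_)
    (Submodule.tmul_mem_baseChange_of_mem (1 : R) hs) (hδ r)
  change a * b ∈ RingHom.ker ε₀ ^ (q + 1)
  rw [Submodule.pow_succ]
  exact Ideal.mul_mem_mul ha (mem_centralPow_one.1 (centralPow_anti hp hb)).2

/-- The filtration by powers of `ker ε₀` begins with the whole space at `q = 0` and reaches zero,
and each application of the map goes one level down. -/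
lemma isNilpotent_of_augPow (hJ : IsNilpotent (RingHom.ker ε₀)) {T : Module.End k (R ⊗[k] D)}
    (hT : ∀ q, ∀ x ∈ (augPow ε₀ q).baseChange R, T x ∈ (augPow ε₀ (q + 1)).baseChange R) :
    IsNilpotent T := by
  obtain ⟨N, hN⟩ := hJ
  refine ⟨N, LinearMap.ext fun x => ?_⟩
  have key (q : ℕ) : (T ^ q) x ∈ (augPow ε₀ q).baseChange R := by
    induction q with
    | zero =>
      have h : augPow ε₀ 0 = ⊤ := by
        rw [augPow, Submodule.pow_zero, Ideal.one_eq_top]; rfl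
      rw [h]
      exact Submodule.mem_baseChange_top _
    | succ q ih => rw [pow_succ']; exact hT q _ ih
  have := key N
  have h : augPow ε₀ N = ⊥ := by rw [augPow, hN]; rfl
  rw [h, Submodule.baseChange_bot] at this
  exact this

lemma isNilpotent_tensorDer (hJ : IsNilpotent (RingHom.ker ε₀)) (hp : 1 ≤ p)
    (hδ : ∀ r, δ r ∈ (centralPow ε₀ p).baseChange R) : IsNilpotent (tensorDer δ) :=
  isNilpotent_of_augPow hJ fun _ _ => tensorDer_mem_of_mem_augPow hp hδ

lemma tensorDer_one : tensorDer δ 1 = 0 := by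
  rw [Algebra.TensorProduct.one_def, tensorDer_tmul, Derivation.map_one_eq_zero, zero_mul]

end TensorDerivation

/-! ### Exponentials of nilpotent derivations -/

section Exponential

variable {k : Type u} [Field k] [CharZero k]

/-- The rational vector space underlying a vector space over a field of characteristic zero. -/
@[reducible] def ratModule (k M : Type u) [Field k] [CharZero k] [AddCommGroup M] [Module k M] :
    Module ℚ M :=
  Module.compHom M (algebraMap ℚ k)

section

variable {M M' : Type u} [AddCommGroup M] [Module k M] [AddCommGroup M'] [Module k M']

/-- The exponential of a nilpotent endomorphism of a vector space. -/
noncomputable def nilExp (T : Module.End k M) : Module.End k M :=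
  letI := ratModule k M
  IsNilpotent.exp T

lemma nilExp_nilExp_neg {T : Module.End k M} (hT : IsNilpotent T) (x : M) :
    nilExp T (nilExp (-T) x) = x := by
  let := ratModule k M
  exact LinearMap.congr_fun (IsNilpotent.exp_mul_exp_neg_self hT) x

lemma nilExp_neg_nilExp {T : Module.End k M} (hT : IsNilpotent T) (x : M) :
    nilExp (-T) (nilExp T x) = x := by
  let := ratModule k M
  exact LinearMap.congr_fun (IsNilpotent.exp_neg_mul_exp_self hT) x

lemma nilExp_comm {T : Module.End k M} {T' : Module.End k M'} (hT : IsNilpotent T)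
    (hT' : IsNilpotent T') {g : M →ₗ[k] M'} (h : ∀ x, T' (g x) = g (T x)) (x : M) :
    nilExp T' (g x) = g (nilExp T x) := by
  let := ratModule k M
  let := ratModule k M'
  exact LinearMap.congr_fun (Module.End.commute_exp_left_of_commute hT hT'
    (g := g) (LinearMap.ext h)) x

lemma nilExp_mul {B : Type u} [Ring B] [Algebra k B] {T : B →ₗ[k] B} (hT : IsNilpotent T)
    (h : ∀ x y, T (x * y) = x * T y + T x * y) (x y : B) :
    nilExp T (x * y) = nilExp T x * nilExp T y := by
  let := ratModule k B
  exact Module.End.exp_mul_of_derivation k B T h hT x y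

/-- What remains of the exponential series are the terms of order at least two, and these lie in `W`
since `T² x` does and `W` is stable under `T`. It serves both for `W = ⊥` and for the next step of a
filtration. -/
lemma nilExp_sub_sub_mem {T : Module.End k M} (hT : IsNilpotent T) {W : Submodule k M}
    (hW : ∀ x ∈ W, T x ∈ W) {x : M} (hx : T (T x) ∈ W) : nilExp T x - x - T x ∈ W := by
  let := ratModule k M
  obtain ⟨N, hN⟩ := hT
  have hpow (n : ℕ) : (T ^ (n + 2)) x ∈ W := by
    induction n with
    | zero => simpa [pow_two] using hx
    | succ n ih => rw [add_right_comm, pow_succ']; exact hW _ ih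
  -- The sum is taken up to `N + 2` so that the terms of order zero and one can be split off for
  -- every `N`, even `N = 0`.
  have h : nilExp T = ∑ i ∈ Finset.range (N + 2), (i.factorial : ℚ)⁻¹ • T ^ i :=
    IsNilpotent.exp_eq_sum (pow_eq_zero_of_le (by omega) hN)
  rw [h, Finset.sum_range_succ', Finset.sum_range_succ']
  simp only [LinearMap.add_apply, LinearMap.sum_apply, LinearMap.smul_apply]
  have : ∑ i ∈ Finset.range N, (((i + 1 + 1).factorial : ℚ)⁻¹ • (T ^ (i + 1 + 1)) x) ∈ W :=
    sum_mem fun i _ => W.smul_mem (algebraMap ℚ k _) (hpow i)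
  convert this using 1
  simp

lemma nilExp_sub_mem {T : Module.End k M} (hT : IsNilpotent T) {W : Submodule k M}
    (hW : ∀ x, T x ∈ W) (x : M) : nilExp T x - x ∈ W := by
  have := add_mem (nilExp_sub_sub_mem hT (fun x _ => hW x) (hW (T x))) (hW x)
  rwa [sub_add_cancel] at this

end

variable {D R : Type u} [Ring D] [Algebra k D] [CommRing R] [Algebra k R]
  {ε₀ : D →ₐ[k] k} {δ : Derivation k R (R ⊗[k] D)} {p : ℕ}

/-- The exponential of `tensorDer δ` as an automorphism of algebras. -/
noncomputable def expEquiv (hJ : IsNilpotent (RingHom.ker ε₀)) (hp : 1 ≤ p)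
    (hδ : ∀ r, δ r ∈ (centralPow ε₀ p).baseChange R) : (R ⊗[k] D) ≃ₐ[k] (R ⊗[k] D) :=
  AlgEquiv.ofLinearEquiv
    { nilExp (tensorDer δ) with
      invFun := nilExp (-tensorDer δ)
      left_inv := nilExp_neg_nilExp (isNilpotent_tensorDer hJ hp hδ)
      right_inv := nilExp_nilExp_neg (isNilpotent_tensorDer hJ hp hδ) }
    (by
      -- A derivation kills `1`, so its exponential fixes `1`.
      have := nilExp_sub_sub_mem (isNilpotent_tensorDer hJ hp hδ) (W := ⊥) (x := 1)
        (by rintro _ rfl; simp) (by simp [tensorDer_one])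
      rw [tensorDer_one, sub_zero] at this
      exact sub_eq_zero.1 this)
    (nilExp_mul (isNilpotent_tensorDer hJ hp hδ) (tensorDer_mul hδ))

variable (hJ : IsNilpotent (RingHom.ker ε₀)) (hp : 1 ≤ p)
    (hδ : ∀ r, δ r ∈ (centralPow ε₀ p).baseChange R)

/-- For `p ≥ 1` the values of `δ` have zero augmentation, so the derivation, and with it its
exponential minus the identity, maps into the kernel of `id ⊗ ε₀`. -/
lemma idTensor_expEquiv (x : R ⊗[k] D) : idTensor ε₀ R (expEquiv hJ hp hδ x) = idTensor ε₀ R x := by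
  have h (x : R ⊗[k] D) : tensorDer δ x ∈
      (LinearMap.ker (idTensor ε₀ R).toLinearMap).restrictScalars k := by
    change idTensor ε₀ R (tensorDer δ x) = 0
    induction x with
    | zero => simp
    | add x y hx hy => rw [map_add, map_add, hx, hy, add_zero]
    | tmul r d =>
      rw [tensorDer_tmul, map_mul, idTensor_eq_zero_of_mem_baseChange (fun d hd =>
        (mem_centralPow_one.1 (centralPow_anti hp hd)).2) (hδ r), zero_mul]
  have := nilExp_sub_mem (isNilpotent_tensorDer hJ hp hδ) h x
  change idTensor ε₀ R (_ - _) = 0 at this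
  rw [map_sub] at this
  exact sub_eq_zero.1 this

/-- To first order, the inverse of `expEquiv` is `1 - δ`. -/
lemma expEquiv_symm_tmul_one (r : R) : (expEquiv hJ hp hδ).symm (r ⊗ₜ 1) - r ⊗ₜ 1 + δ r ∈
    (centralPow ε₀ (p + 1)).baseChange R := by
  have := nilExp_sub_sub_mem (isNilpotent_tensorDer hJ hp hδ).neg
    (W := ((centralPow ε₀ (p + 1)).baseChange R).restrictScalars k) (x := r ⊗ₜ 1)
    -- The second-order term lies in `R ⊗ S_(p+p)`, hence in `R ⊗ S_(p+1)`, because `p ≥ 1`.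
    (fun x hx => neg_mem (Submodule.baseChange_le_baseChange (centralPow_anti (by omega))
      (tensorDer_mem_of_mem_centralPow hδ hx))) (by
      simp only [LinearMap.neg_apply, map_neg, neg_neg, tensorDer_tmul,
        ← Algebra.TensorProduct.one_def, mul_one]
      exact Submodule.baseChange_le_baseChange (centralPow_anti (by omega))
        (tensorDer_mem_of_mem_centralPow hδ (hδ r)))
  rw [LinearMap.neg_apply, sub_neg_eq_add, tensorDer_tmul, ← Algebra.TensorProduct.one_def,
    mul_one] at this
  exact this

lemma expEquiv_naturality {R' : Type u} [CommRing R'] [Algebra k R']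
    {δ' : Derivation k R' (R' ⊗[k] D)}
    (hδ' : ∀ r, δ' r ∈ (centralPow ε₀ p).baseChange R') (f : R →ₐ[k] R')
    (h : ∀ r, δ' (f r) = Algebra.TensorProduct.map f (AlgHom.id k D) (δ r)) (x : R ⊗[k] D) :
    expEquiv hJ hp hδ' (Algebra.TensorProduct.map f (AlgHom.id k D) x) =
      Algebra.TensorProduct.map f (AlgHom.id k D) (expEquiv hJ hp hδ x) := by
  refine nilExp_comm (isNilpotent_tensorDer hJ hp hδ) (isNilpotent_tensorDer hJ hp hδ')
    (g := (Algebra.TensorProduct.map f (AlgHom.id k D)).toLinearMap) (fun x => ?_) x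
  simp only [AlgHom.toLinearMap_apply]
  induction x with
  | zero => simp
  | add x y hx hy => simp only [map_add, hx, hy]
  | tmul r d => simp [h]

end Exponential

/-! ### The automorphism of `R ⊗ D` attached to a central lift of `R` -/

section CentralLift

variable {k D R : Type u} [Field k] [Ring D] [Algebra k D] [CommRing R] [Algebra k R]
  {ε₀ : D →ₐ[k] k} {f : R →ₐ[k] R ⊗[k] D}

lemma commute_of_sub_mem {r : R} {x : R ⊗[k] D}
    (h : x - r ⊗ₜ 1 ∈ (centralPow ε₀ 1).baseChange R) (y : R ⊗[k] D) : y * x = x * y := by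
  have h1 := commute_of_mem_baseChange_centralPow h y
  rw [mul_sub, sub_mul] at h1
  have h2 : (r ⊗ₜ[k] (1 : D)) * y = y * (r ⊗ₜ[k] (1 : D)) := Algebra.commutes r y
  rw [h2] at h1
  exact sub_left_inj.1 h1

/-- The endomorphism `r ⊗ d ↦ f r * (1 ⊗ d)` of `R ⊗ D`. -/
noncomputable def centralLiftHom (hf : ∀ r, f r - r ⊗ₜ 1 ∈ (centralPow ε₀ 1).baseChange R) :
    R ⊗[k] D →ₐ[k] R ⊗[k] D :=
  Algebra.TensorProduct.lift f Algebra.TensorProduct.includeRight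
    fun r _ => (commute_of_sub_mem (hf r) _).symm

@[simp]
lemma centralLiftHom_tmul (hf : ∀ r, f r - r ⊗ₜ 1 ∈ (centralPow ε₀ 1).baseChange R) (r : R)
    (d : D) : centralLiftHom hf (r ⊗ₜ d) = f r * (1 ⊗ₜ d) := by
  rfl

/-- The map is the identity plus a nilpotent one: on `r ⊗ s` the difference is `(1 ⊗ s) (f r - r ⊗
1)`, and the second factor has coefficients in `ker ε₀`, so the power of `ker ε₀` goes up by one. -/
lemma centralLiftHom_bijective (hJ : IsNilpotent (RingHom.ker ε₀))
    (hf : ∀ r, f r - r ⊗ₜ 1 ∈ (centralPow ε₀ 1).baseChange R) :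
    Function.Bijective (centralLiftHom hf) := by
  have h : IsNilpotent ((centralLiftHom hf).toLinearMap - (1 : Module.End k (R ⊗[k] D))) := by
    refine isNilpotent_of_augPow hJ fun q x hx => ?_
    refine Submodule.baseChange_induction (P := fun x => ((centralLiftHom hf).toLinearMap -
      (1 : Module.End k (R ⊗[k] D))) x ∈ (augPow ε₀ (q + 1)).baseChange R)
      (by rw [map_zero]; exact zero_mem _)
      (fun x y hx hy => by rw [map_add]; exact add_mem hx hy) (fun r s hs => ?_) hx
    have h1 : ((centralLiftHom hf).toLinearMap - (1 : Module.End k (R ⊗[k] D))) (r ⊗ₜ s) =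
        (1 ⊗ₜ s) * (f r - r ⊗ₜ 1) := by
      rw [commute_of_mem_baseChange_centralPow (hf r), sub_mul]
      simp
    rw [h1]
    refine Submodule.mul_mem_baseChange (fun a ha b hb => ?_)
      (Submodule.tmul_mem_baseChange_of_mem (1 : R) hs) (hf r)
    change a * b ∈ RingHom.ker ε₀ ^ (q + 1)
    rw [Submodule.pow_succ]
    exact Ideal.mul_mem_mul ha (mem_centralPow_one.1 hb).2
  have := (Module.End.isUnit_iff _).1 h.isUnit_add_one
  rw [sub_add_cancel] at this
  exact this

lemma idTensor_centralLiftHom (hf : ∀ r, f r - r ⊗ₜ 1 ∈ (centralPow ε₀ 1).baseChange R)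
    (x : R ⊗[k] D) : idTensor ε₀ R (centralLiftHom hf x) = idTensor ε₀ R x := by
  induction x with
  | zero => simp
  | add x y hx hy => simp only [map_add, hx, hy]
  | tmul r d =>
    have h := idTensor_eq_zero_of_mem_baseChange (fun d hd => (mem_centralPow_one.1 hd).2) (hf r)
    rw [map_sub, sub_eq_zero] at h
    rw [centralLiftHom_tmul, map_mul, h, ← map_mul]
    simp

lemma centralLiftHom_naturality {R' : Type u} [CommRing R'] [Algebra k R']
    {f' : R' →ₐ[k] R' ⊗[k] D} (hf : ∀ r, f r - r ⊗ₜ 1 ∈ (centralPow ε₀ 1).baseChange R)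
    (hf' : ∀ r, f' r - r ⊗ₜ 1 ∈ (centralPow ε₀ 1).baseChange R') (g : R →ₐ[k] R')
    (h : ∀ r, f' (g r) = Algebra.TensorProduct.map g (AlgHom.id k D) (f r)) (x : R ⊗[k] D) :
    centralLiftHom hf' (Algebra.TensorProduct.map g (AlgHom.id k D) x) =
      Algebra.TensorProduct.map g (AlgHom.id k D) (centralLiftHom hf x) := by
  induction x with
  | zero => simp
  | add x y hx hy => simp only [map_add, hx, hy]
  | tmul r d => simp [h]

/-- `centralLiftHom` as an automorphism of `R ⊗ D`. -/
noncomputable def centralLift (hJ : IsNilpotent (RingHom.ker ε₀))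
    (hf : ∀ r, f r - r ⊗ₜ 1 ∈ (centralPow ε₀ 1).baseChange R) : R ⊗[k] D ≃ₐ[k] R ⊗[k] D :=
  AlgEquiv.ofBijective _ (centralLiftHom_bijective hJ hf)

end CentralLift

/-! ### Restriction maps and glueing over admissible coverings -/

namespace GeneralizedTopology

variable {X : Type u} {T : GeneralizedTopology X}

/-- The intersection of two open subsets. -/
def inter (U V : T.Opens) : T.Opens := ⟨U.1 ∩ V.1, T.isOpen_inter _ _ U.2 V.2⟩

lemma inter_le_left (U V : T.Opens) : inter U V ≤ U := by
  change U.1 ∩ V.1 ⊆ U.1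
  exact Set.inter_subset_left

lemma inter_le_right (U V : T.Opens) : inter U V ≤ V := by
  change U.1 ∩ V.1 ⊆ V.1
  exact Set.inter_subset_right

lemma le_inter {U V W : T.Opens} (h : W ≤ U) (h' : W ≤ V) : W ≤ inter U V := by
  change W.1 ⊆ U.1 ∩ V.1
  exact Set.subset_inter h h'

lemma le_whole (U : T.Opens) : U ≤ T.whole := by
  change U.1 ⊆ Set.univ
  exact Set.subset_univ _

/-- The whole space is a terminal object of the category of open subsets. -/
def isTerminalWhole (T : GeneralizedTopology X) : Limits.IsTerminal T.whole :=
  Limits.IsTerminal.ofUniqueHom (fun U => homOfLE (le_whole U)) fun _ _ => Subsingleton.elim _ _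

/-- The restriction maps of a presheaf of sets. -/
def resMap (P : T.Opensᵒᵖ ⥤ Type u) {U V : T.Opens} (h : V ≤ U) :
    P.obj (op U) → P.obj (op V) :=
  P.map (homOfLE h).op

lemma resMap_resMap (P : T.Opensᵒᵖ ⥤ Type u) {U V W : T.Opens} (h : V ≤ U) (h' : W ≤ V)
    (x : P.obj (op U)) : resMap P h' (resMap P h x) = resMap P (h'.trans h) x := by
  simp only [resMap]
  rw [← ConcreteCategory.comp_apply, ← P.map_comp]
  rfl

lemma resMap_self (P : T.Opensᵒᵖ ⥤ Type u) {U : T.Opens} (h : U ≤ U)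
    (x : P.obj (op U)) : resMap P h x = x := by
  have : (homOfLE h).op = 𝟙 (op U) := Subsingleton.elim _ _
  simp only [resMap]
  rw [this, P.map_id]
  rfl

/-- The presheaf `P` satisfies the sheaf condition on the open subsets of `U`. -/
def IsSheafBelow (P : T.Opensᵒᵖ ⥤ Type u) (U : T.Opens) : Prop :=
  ∀ V ≤ U, ∀ S ∈ T.site V, Presieve.IsSheafFor P (S : Sieve V).arrows

lemma isSheafBelow_of_isSheaf {P : T.Opensᵒᵖ ⥤ Type u} (h : Presieve.IsSheaf T.site P)
    (U : T.Opens) : IsSheafBelow P U := fun _ _ _ hS => h _ hS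

/-- The sheaf condition in terms of restrictions. -/
lemma isSheafFor_iff_resMap {P : T.Opensᵒᵖ ⥤ Type u} {V : T.Opens} {S : Sieve V} :
    Presieve.IsSheafFor P S.arrows ↔
      (∀ x y : P.obj (op V), (∀ (W : T.Opens) (h : W ≤ V), S (homOfLE h) →
        resMap P h x = resMap P h y) → x = y) ∧
      ∀ x : ∀ (W : T.Opens) (h : W ≤ V), S (homOfLE h) → P.obj (op W),
        (∀ (W W' : T.Opens) (h : W ≤ V) (h' : W' ≤ W) (hW : S (homOfLE h))
          (hW' : S (homOfLE (h'.trans h))), resMap P h' (x W h hW) = x W' (h'.trans h) hW') →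
        ∃ y : P.obj (op V), ∀ (W : T.Opens) (h : W ≤ V) (hW : S (homOfLE h)),
          resMap P h y = x W h hW := by
  rw [← Presieve.isSeparatedFor_and_exists_isAmalgamation_iff_isSheafFor]
  refine and_congr ?_ ?_
  · refine ⟨fun h x y hxy => h.ext fun W f hf => hxy W (leOfHom f) hf, fun h x y z hy hz => ?_⟩
    exact h _ _ fun W hWV hW => (hy (homOfLE hWV) hW).trans (hz (homOfLE hWV) hW).symm
  · constructor
    · intro h x hx
      have hc := (Presieve.compatible_iff_sieveCompatible
        (fun W f hf => x W (leOfHom f) hf : Presieve.FamilyOfElements P S.arrows)).2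
          fun W W' f g hf => (hx W W' (leOfHom f) (leOfHom g) hf (S.downward_closed hf g)).symm
      obtain ⟨y, hy⟩ := h _ hc
      exact ⟨y, fun W h hW => hy (homOfLE h) hW⟩
    · intro h x hx
      rw [Presieve.compatible_iff_sieveCompatible] at hx
      obtain ⟨y, hy⟩ := h (fun W h hW => x (homOfLE h) hW)
        fun W W' h h' hW hW' => (hx (homOfLE h) (homOfLE h') hW).symm
      exact ⟨y, fun W f hf => hy W (leOfHom f) hf⟩

/-- A covering sieve of `X` given by an admissible covering. -/
def coverSieve (𝒰 : Set (Set X)) : Sieve T.whole where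
  arrows V _ := ∃ U : T.Opens, U.1 ∈ 𝒰 ∧ V ≤ U
  downward_closed := by
    rintro V W _ ⟨U, hU, h⟩ g
    exact ⟨U, hU, (leOfHom g).trans h⟩

lemma coverSieve_mem {𝒰 : Set (Set X)} (h : T.IsCovOf T.whole 𝒰) :
    coverSieve 𝒰 ∈ T.site T.whole :=
  ⟨𝒰, h, fun V _ hV => ⟨V, hV, le_rfl⟩⟩

/-- The sieve on `V` of the open subsets contained in a member of an admissible covering. -/
lemma coverSieve_pullback_mem {𝒰 : Set (Set X)} (h : T.IsCovOf T.whole 𝒰) (V : T.Opens) :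
    (coverSieve 𝒰).pullback (homOfLE (le_whole V)) ∈ T.site V :=
  T.site.pullback_stable _ (coverSieve_mem h)

/-- Glueing of sections over an admissible covering. -/
lemma exists_glue {P : T.Opensᵒᵖ ⥤ Type u} (hP : Presieve.IsSheaf T.site P)
    {𝒰 : Set (Set X)} (h𝒰 : T.IsCovOf T.whole 𝒰) (V : T.Opens)
    (x : ∀ U : T.Opens, U.1 ∈ 𝒰 → P.obj (op (inter V U)))
    (hx : ∀ (U U' : T.Opens) (hU : U.1 ∈ 𝒰) (hU' : U'.1 ∈ 𝒰) (W : T.Opens)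
      (hWU : W ≤ inter V U) (hWU' : W ≤ inter V U'),
      resMap P hWU (x U hU) = resMap P hWU' (x U' hU')) :
    ∃ y : P.obj (op V), ∀ (U : T.Opens) (hU : U.1 ∈ 𝒰),
      resMap P (inter_le_left V U) y = x U hU := by
  obtain ⟨-, hglue⟩ := isSheafFor_iff_resMap.1 (hP _ (coverSieve_pullback_mem h𝒰 V))
  -- The data on the covering are extended to the sieve it generates: an open set inside some `V ∩
  -- U` gets the restriction of `x U`, and by `hx` the choice of `U` does not matter.
  have key : ∀ (W : T.Opens) (h : W ≤ V),
      (coverSieve 𝒰).pullback (homOfLE (le_whole V)) (homOfLE h) → ∃ z : P.obj (op W),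
        ∀ (U : T.Opens) (hU : U.1 ∈ 𝒰) (hWU : W ≤ inter V U), z = resMap P hWU (x U hU) := by
    rintro W h ⟨U, hU, hWU⟩
    exact ⟨resMap P (le_inter h hWU) (x U hU), fun U' hU' hWU' => hx _ _ _ _ _ _ _⟩
  choose z hz using key
  obtain ⟨y, hy⟩ := hglue z (by
    rintro W W' h h' ⟨U, hU, hWU⟩ hW'
    rw [hz W h ⟨U, hU, hWU⟩ U hU (le_inter h hWU), resMap_resMap,
      hz W' _ hW' U hU ((h'.trans (le_inter h hWU)))])
  refine ⟨y, fun U hU => ?_⟩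
  exact (hy _ (inter_le_left V U) ⟨U, hU, inter_le_right V U⟩).trans
    ((hz _ _ _ U hU le_rfl).trans (resMap_self P _ _))

lemma eq_of_resMap_cover {P : T.Opensᵒᵖ ⥤ Type u} (hP : Presieve.IsSheaf T.site P)
    {𝒰 : Set (Set X)} (h𝒰 : T.IsCovOf T.whole 𝒰) {V : T.Opens} {x y : P.obj (op V)}
    (h : ∀ U : T.Opens, U.1 ∈ 𝒰 →
      resMap P (inter_le_left V U) x = resMap P (inter_le_left V U) y) : x = y := by
  refine (isSheafFor_iff_resMap.1 (hP _ (coverSieve_pullback_mem h𝒰 V))).1 x y ?_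
  rintro W hW ⟨U, hU, hWU⟩
  rw [← resMap_resMap P (inter_le_left V U) (le_inter hW hWU), h U hU, resMap_resMap]

end GeneralizedTopology

/-! ### Vanishing of `H¹` and Čech cocycles -/

section Cech

open GeneralizedTopology

variable {X : Type u} {T : GeneralizedTopology X}

/-- The restriction maps of a presheaf of abelian groups. -/
def resHom (F : T.Opensᵒᵖ ⥤ AddCommGrpCat.{u}) {U V : T.Opens} (h : V ≤ U) :
    F.obj (op U) →+ F.obj (op V) :=
  (F.map (homOfLE h).op).hom

lemma resHom_resHom (F : T.Opensᵒᵖ ⥤ AddCommGrpCat.{u}) {U V W : T.Opens} (h : V ≤ U)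
    (h' : W ≤ V) (x : F.obj (op U)) :
    resHom F h' (resHom F h x) = resHom F (h'.trans h) x :=
  resMap_resMap (F ⋙ forget _) h h' x

lemma resHom_self (F : T.Opensᵒᵖ ⥤ AddCommGrpCat.{u}) {U : T.Opens} (h : U ≤ U)
    (x : F.obj (op U)) : resHom F h x = x :=
  resMap_self (F ⋙ forget _) h x

lemma app_resHom {F G : T.Opensᵒᵖ ⥤ AddCommGrpCat.{u}} (f : F ⟶ G) {U V : T.Opens} (h : V ≤ U)
    (x : F.obj (op U)) : (f.app (op V)).hom (resHom F h x) = resHom G h ((f.app (op U)).hom x) :=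
  congr($(f.naturality (homOfLE h).op) x)

lemma isSheaf_forget (F : Sheaf T.site AddCommGrpCat.{u}) :
    Presieve.IsSheaf T.site (F.obj ⋙ forget AddCommGrpCat.{u}) :=
  (isSheaf_iff_isSheaf_of_type _ _).1
    ((Presheaf.isSheaf_iff_isSheaf_forget T.site _ (forget AddCommGrpCat.{u})).1 F.property)

lemma isSheaf_of_forget {F : T.Opensᵒᵖ ⥤ AddCommGrpCat.{u}}
    (h : Presieve.IsSheaf T.site (F ⋙ forget AddCommGrpCat.{u})) : Presheaf.IsSheaf T.site F :=
  (Presheaf.isSheaf_iff_isSheaf_forget T.site _ (forget AddCommGrpCat.{u})).2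
    ((isSheaf_iff_isSheaf_of_type _ _).2 h)

/-- The presheaf `V ↦ ∏ F(V ∩ U)`, where `U` runs through the open subsets in `𝒰`. -/
def coverPresheaf (F : T.Opensᵒᵖ ⥤ AddCommGrpCat.{u}) (𝒰 : Set (Set X)) :
    T.Opensᵒᵖ ⥤ AddCommGrpCat.{u} where
  obj V := AddCommGrpCat.of (∀ U : {U : T.Opens // U.1 ∈ 𝒰}, F.obj (op (inter V.unop U.1)))
  map {V W} f := AddCommGrpCat.ofHom
    { toFun := fun x U => resHom F (le_inter ((inter_le_left _ _).trans (leOfHom f.unop))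
        (inter_le_right _ _)) (x U)
      map_zero' := by funext U; exact map_zero _
      map_add' := fun x y => by funext U; exact map_add _ _ _ }
  map_id V := by
    ext x U
    exact resHom_self F _ _
  map_comp f g := by
    ext x U
    exact (resHom_resHom F _ _ _).symm

/-- The sheaf condition is checked in each factor separately, on the sieve pulled back from `V` to
`V ∩ U`. -/
lemma isSheaf_coverPresheaf (F : Sheaf T.site AddCommGrpCat.{u}) (𝒰 : Set (Set X)) :
    Presheaf.IsSheaf T.site (coverPresheaf F.obj 𝒰) := by
  refine isSheaf_of_forget fun V S hS => isSheafFor_iff_resMap.2 ⟨fun x y h => ?_, fun x hx => ?_⟩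
  · change ∀ U : {U : T.Opens // U.1 ∈ 𝒰}, F.obj.obj (op (inter V U.1)) at x y
    funext U
    refine (isSheafFor_iff_resMap.1 (isSheaf_forget F _
      (T.site.pullback_stable (homOfLE (inter_le_left V U.1)) hS))).1 _ _ fun W hW hWS => ?_
    have := congrFun (h W (hW.trans (inter_le_left _ _)) hWS) U
    -- For `W ≤ V ∩ U` the `U`-component over `W` is a section over `W ∩ U`; restriction along `W ≤
    -- W ∩ U` makes it a section over `W`.
    have := congrArg (resHom F.obj (le_inter le_rfl (hW.trans (inter_le_right _ _)))) this
    exact (resHom_resHom F.obj _ _ _).symm.trans (this.trans (resHom_resHom F.obj _ _ _))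
  · have key (U : {U : T.Opens // U.1 ∈ 𝒰}) := (isSheafFor_iff_resMap.1 (isSheaf_forget F _
      (T.site.pullback_stable (homOfLE (inter_le_left V U.1)) hS))).2
        (fun W hW hWS => resHom F.obj (le_inter le_rfl (hW.trans (inter_le_right _ _)))
          (x W (hW.trans (inter_le_left _ _)) hWS U))
        (by
          intro W W' h h' hWS hWS'
          have := congrFun (hx W W' (h.trans (inter_le_left _ _)) h' hWS hWS') U
          have := congrArg (resHom F.obj
            (le_inter le_rfl ((h'.trans h).trans (inter_le_right _ _)))) this
          refine (resHom_resHom F.obj _ _ _).trans (Eq.trans ?_ this)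
          exact (resHom_resHom F.obj _ _ _).symm)
    choose y hy using key
    refine ⟨y, fun W hW hWS => funext fun U => ?_⟩
    have hWS' := S.downward_closed hWS (homOfLE (inter_le_left W U.1))
    refine (hy U (inter W U.1) (le_inter ((inter_le_left _ _).trans hW) (inter_le_right _ _))
      hWS').trans ?_
    have := congrFun (hx W (inter W U.1) hW (inter_le_left _ _) hWS hWS') U
    refine (congrArg (resHom F.obj _) this.symm).trans ?_
    exact (resHom_resHom F.obj _ _ _).trans (resHom_self F.obj _ _)

/-- The sheaf `V ↦ ∏ F(V ∩ U)`, where `U` runs through the open subsets in `𝒰`. -/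
def coverSheaf (F : Sheaf T.site AddCommGrpCat.{u}) (𝒰 : Set (Set X)) :
    Sheaf T.site AddCommGrpCat.{u} where
  obj := coverPresheaf F.obj 𝒰
  property := isSheaf_coverPresheaf F 𝒰

/-- The embedding of a sheaf into the sheaf `V ↦ ∏ F(V ∩ U)`. -/
def toCoverSheaf (F : Sheaf T.site AddCommGrpCat.{u}) (𝒰 : Set (Set X)) :
    F ⟶ coverSheaf F 𝒰 where
  hom :=
    { app := fun V => AddCommGrpCat.ofHom
        { toFun := fun x U => resHom F.obj (inter_le_left V.unop U.1) x
          map_zero' := by funext U; exact map_zero _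
          map_add' := fun x y => by funext U; exact map_add _ _ _ }
      naturality := fun V W f => by
        ext x
        funext U
        change resHom F.obj _ (resHom F.obj (leOfHom f.unop) x) =
          resHom F.obj _ (resHom F.obj _ x)
        rw [resHom_resHom, resHom_resHom] }

lemma mono_toCoverSheaf (F : Sheaf T.site AddCommGrpCat.{u}) {𝒰 : Set (Set X)}
    (h𝒰 : T.IsCovOf T.whole 𝒰) : Mono (toCoverSheaf F 𝒰) := by
  have : Sheaf.IsLocallyInjective (toCoverSheaf F 𝒰) := by
    rw [Sheaf.isLocallyInjective_iff_injective]
    intro V x y h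
    induction V with | op V => ?_
    exact eq_of_resMap_cover (isSheaf_forget F) h𝒰 fun U hU => congrFun h ⟨U, hU⟩
  exact Sheaf.mono_of_isLocallyInjective _

/-- Sections of the cokernel of a monomorphism `f : F ⟶ G` lift to `G` if `H¹(F) = 0`. -/
lemma exists_lift_of_subsingleton_H_one {F G : Sheaf T.site AddCommGrpCat.{u}} (f : F ⟶ G) [Mono f]
    [Subsingleton (Sheaf.H F 1)] (q : (Limits.cokernel f).obj.obj (op T.whole)) :
    ∃ g : G.obj.obj (op T.whole), ((Limits.cokernel.π f).hom.app _).hom g = q := by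
  let S : ShortComplex (Sheaf T.site AddCommGrpCat.{u}) :=
    ShortComplex.mk f (Limits.cokernel.π f) (Limits.cokernel.condition f)
  have hS : S.ShortExact :=
    { exact := ShortComplex.exact_cokernel f
      mono_f := ‹_›
      epi_g := inferInstanceAs (Epi (Limits.cokernel.π f)) }
  -- Global sections are `H⁰`. The obstruction to lifting `q` is its image under the connecting map
  -- into `H¹(F)`, which is zero.
  obtain ⟨x, hx⟩ := Abelian.Ext.covariant_sequence_exact₃ _ hS
    ((Sheaf.H.equiv₀ S.X₃ (isTerminalWhole T)).symm q) (zero_add 1)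
    (Subsingleton.elim (α := Sheaf.H F 1) _ _)
  refine ⟨Sheaf.H.equiv₀ G (isTerminalWhole T) x, ?_⟩
  have h1 := Sheaf.H.equiv₀_naturality (isTerminalWhole T) (Limits.cokernel.π f) x
  refine h1.trans ?_
  rw [Sheaf.H.map_apply]
  exact (congrArg _ hx).trans (AddEquiv.apply_symm_apply _ _)

/-- Sections of `G` which vanish in the cokernel of a monomorphism `f : F ⟶ G` come from `F`. -/
lemma exists_of_cokernel_π_eq_zero {F G : Sheaf T.site AddCommGrpCat.{u}} (f : F ⟶ G) [Mono f]
    {V : T.Opens} (g : G.obj.obj (op V))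
    (hg : ((Limits.cokernel.π f).hom.app (op V)).hom g = 0) :
    ∃ x : F.obj.obj (op V), (f.hom.app (op V)).hom x = g := by
  let S : ShortComplex (Sheaf T.site AddCommGrpCat.{u}) :=
    ShortComplex.mk f (Limits.cokernel.π f) (Limits.cokernel.condition f)
  have hS : S.Exact := ShortComplex.exact_cokernel f
  -- Taking sections over `V` is left exact, which suffices for exactness at `G` because `f` is
  -- mono.
  let E : Sheaf T.site AddCommGrpCat.{u} ⥤ AddCommGrpCat.{u} :=
    sheafToPresheaf T.site AddCommGrpCat.{u} ⋙ (evaluation _ _).obj (op V)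
  have : Mono S.f := ‹_›
  have hE : (S.map E).Exact := hS.map_of_mono_of_preservesKernel E this inferInstance
  exact (ShortComplex.ab_exact_iff _).1 hE g hg

/-- If `H¹(X, F) = 0`, then the `1`-cocycles of an admissible covering with values in `F` are
coboundaries. -/
theorem exists_coboundary (F : Sheaf T.site AddCommGrpCat.{u}) [Subsingleton (Sheaf.H F 1)]
    {𝒰 : Set (Set X)} (h𝒰 : T.IsCovOf T.whole 𝒰)
    (s : ∀ U V : {U : T.Opens // U.1 ∈ 𝒰}, F.obj.obj (op (inter U.1 V.1)))
    (hs : ∀ (U V U' : {U : T.Opens // U.1 ∈ 𝒰}) (W : T.Opens) (hU : W ≤ U.1) (hV : W ≤ V.1)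
      (hU' : W ≤ U'.1), resHom F.obj (le_inter hU hV) (s U V) +
        resHom F.obj (le_inter hV hU') (s V U') = resHom F.obj (le_inter hU hU') (s U U')) :
    ∃ t : ∀ U : {U : T.Opens // U.1 ∈ 𝒰}, F.obj.obj (op U.1),
      ∀ U V, resHom F.obj (inter_le_left U.1 V.1) (t U) -
        resHom F.obj (inter_le_right U.1 V.1) (t V) = s U V := by
  have := mono_toCoverSheaf F h𝒰
  set f := toCoverSheaf F 𝒰
  set π := Limits.cokernel.π f
  have hfπ {V : T.Opens} (x : F.obj.obj (op V)) :
      (π.hom.app (op V)).hom ((f.hom.app (op V)).hom x) = 0 :=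
    congr(($(Limits.cokernel.condition f).hom.app (op V)).hom x)
  -- In the larger sheaf the cocycle splits tautologically, by its rows `h U = (s U V)_V`. The
  -- cocycle identity says `h U - h U' = f (s U U')` on overlaps, so the classes of the `h U` in the
  -- cokernel glue to a global section `q`.
  let h (U : {U : T.Opens // U.1 ∈ 𝒰}) : (coverSheaf F 𝒰).obj.obj (op U.1) := fun V => s U V
  obtain ⟨q, hq⟩ := exists_glue (isSheaf_forget (Limits.cokernel f)) h𝒰 T.whole
    (fun U hU => resHom (Limits.cokernel f).obj (inter_le_right _ _)
      ((π.hom.app (op U)).hom (h ⟨U, hU⟩))) (by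
    intro U U' hU hU' W hWU hWU'
    change resHom (Limits.cokernel f).obj _ (resHom (Limits.cokernel f).obj _ _) =
      resHom (Limits.cokernel f).obj _ (resHom (Limits.cokernel f).obj _ _)
    rw [resHom_resHom, resHom_resHom, ← app_resHom, ← app_resHom, ← sub_eq_zero, ← map_sub]
    refine Eq.trans (congrArg _ ?_) (hfπ (resHom F.obj (le_inter (hWU.trans (inter_le_right _ _))
      (hWU'.trans (inter_le_right _ _))) (s ⟨U, hU⟩ ⟨U', hU'⟩)))
    funext V
    change resHom F.obj _ (s ⟨U, hU⟩ V) - resHom F.obj _ (s ⟨U', hU'⟩ V) =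
      resHom F.obj _ (resHom F.obj _ (s ⟨U, hU⟩ ⟨U', hU'⟩))
    rw [resHom_resHom, sub_eq_iff_eq_add]
    exact (hs ⟨U, hU⟩ ⟨U', hU'⟩ V _ ((inter_le_left _ _).trans (hWU.trans (inter_le_right _ _)))
      ((inter_le_left _ _).trans (hWU'.trans (inter_le_right _ _))) (inter_le_right _ _)).symm)
  -- With a global lift `g` of `q`, each `h U - g` dies in the cokernel and so comes from a section
  -- `t U` of `F`. Subtracting the common `g` leaves the coboundary unchanged.
  obtain ⟨g, hg⟩ := exists_lift_of_subsingleton_H_one f q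
  have key (U : {U : T.Opens // U.1 ∈ 𝒰}) : ∃ t : F.obj.obj (op U.1),
      (f.hom.app (op U.1)).hom t = h U - resHom (coverSheaf F 𝒰).obj (le_whole U.1) g := by
    refine exists_of_cokernel_π_eq_zero f _ ?_
    rw [map_sub, app_resHom, hg, sub_eq_zero]
    have := congrArg (resHom (Limits.cokernel f).obj (le_inter (le_whole U.1) le_rfl)) (hq U.1 U.2)
    refine Eq.trans ?_ ((this.symm.trans (resHom_resHom _ _ _ _)))
    rw [resHom_resHom, resHom_self]
  choose t ht using key
  refine ⟨t, fun U V => ?_⟩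
  have hW : inter U.1 V.1 ≤ V.1 := inter_le_right _ _
  -- Only the `V`-component of the identity for `t U'` is used, for `U' = U` and for `U' = V`; the
  -- term in `g` is the same in both.
  have hU (U' : {U : T.Opens // U.1 ∈ 𝒰}) (hU' : inter U.1 V.1 ≤ U'.1) :
      resHom F.obj hU' (t U') = resHom F.obj (le_inter hU' hW) (s U' V) -
        resHom F.obj (le_inter (le_whole _) hW) (g V) := by
    have := congrArg (resHom F.obj (le_inter hU' hW)) (congrFun (ht U') V)
    refine (resHom_resHom F.obj _ _ _).symm.trans (this.trans ?_)
    change resHom F.obj _ (s U' V - resHom F.obj _ (g V)) = _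
    rw [map_sub, resHom_resHom]
  rw [hU U, hU V, sub_sub_sub_cancel_right, sub_eq_iff_eq_add]
  -- The cocycle identity for `U, V, V` removes the remaining term `s V V`.
  have h1 := hs U V V _ (inter_le_left _ _) hW hW
  refine h1.symm.trans ?_
  rw [resHom_self]

end Cech

open GeneralizedTopology

/-! ### Presheaves which satisfy the sheaf condition locally -/

section

variable {X : Type u} {T : GeneralizedTopology X}

/-- A locally bijective map into a sheaf is bijective over the open subsets on which its source
satisfies the sheaf condition. -/
lemma bijective_of_isSheafBelow {P Q : T.Opensᵒᵖ ⥤ AddCommGrpCat.{u}} (φ : P ⟶ Q)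
    [Presheaf.IsLocallyInjective T.site φ] [Presheaf.IsLocallySurjective T.site φ]
    (hQ : Presieve.IsSheaf T.site (Q ⋙ forget AddCommGrpCat.{u})) {U V : T.Opens}
    (hP : IsSheafBelow (P ⋙ forget AddCommGrpCat.{u}) U) (hV : V ≤ U) :
    Function.Bijective (φ.app (op V)).hom := by
  have hinj (V : T.Opens) (hV : V ≤ U) : Function.Injective (φ.app (op V)).hom := by
    intro x y hxy
    refine (isSheafFor_iff_resMap.1 (hP V hV _
      (Presheaf.equalizerSieve_mem T.site φ x y hxy))).1 x y fun W h hW => ?_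
    exact hW
  refine ⟨hinj V hV, fun y => ?_⟩
  have hS := Presheaf.imageSieve_mem T.site φ y
  have key (W : T.Opens) (h : W ≤ V) (hW : Presheaf.imageSieve φ y (homOfLE h)) :
      ∃ x : P.obj (op W), (φ.app (op W)).hom x = resHom Q h y := hW
  choose x hx using key
  obtain ⟨z, hz⟩ := (isSheafFor_iff_resMap.1 (hP V hV _ hS)).2 x (by
    intro W W' h h' hW hW'
    apply hinj W' ((h'.trans h).trans hV)
    refine (app_resHom φ h' _).trans ?_
    rw [hx, hx, resHom_resHom])
  refine ⟨z, (isSheafFor_iff_resMap.1 (hQ _ hS)).1 _ _ fun W h hW => ?_⟩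
  refine (app_resHom φ h z).symm.trans ?_
  exact (congrArg _ (hz W h hW)).trans (hx W h hW)

/-- A presheaf agrees with the associated sheaf over the open subsets on which it satisfies the
sheaf condition. -/
lemma bijective_toSheafify {P : T.Opensᵒᵖ ⥤ AddCommGrpCat.{u}} {U V : T.Opens}
    (hP : IsSheafBelow (P ⋙ forget AddCommGrpCat.{u}) U) (hV : V ≤ U) :
    Function.Bijective ((toSheafify T.site P).app (op V)).hom :=
  bijective_of_isSheafBelow (toSheafify T.site P)
    (isSheaf_forget ((presheafToSheaf T.site AddCommGrpCat.{u}).obj P)) hP hV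

end

/-! ### The sheaf of derivations -/

section Derivations

variable {X : Type u} {T : GeneralizedTopology X} {k : Type u} [Field k]

/-- The restriction maps of a sheaf of commutative algebras. -/
def commRes (C : Sheaf T.site (CommAlgCat.{u} k)) {U V : T.Opens} (h : V ≤ U) :
    C.obj.obj (op U) →ₐ[k] C.obj.obj (op V) :=
  (C.obj.map (homOfLE h).op).hom

lemma commRes_commRes (C : Sheaf T.site (CommAlgCat.{u} k)) {U V W : T.Opens} (h : V ≤ U)
    (h' : W ≤ V) (c : C.obj.obj (op U)) :
    commRes C h' (commRes C h c) = commRes C (h'.trans h) c :=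
  resMap_resMap (C.obj ⋙ forget _) h h' c

lemma commRes_self (C : Sheaf T.site (CommAlgCat.{u} k)) {U : T.Opens} (h : U ≤ U)
    (c : C.obj.obj (op U)) : commRes C h c = c :=
  resMap_self (C.obj ⋙ forget _) h c

variable {C : Sheaf T.site (CommAlgCat.{u} k)} (M : SheafOfModules.{u} (ringSheaf C))

lemma modRes_modRes {U V W : T.Opens} (h : V ≤ U) (h' : W ≤ V) (m : modSections M (op U)) :
    modRes M (homOfLE h').op (modRes M (homOfLE h).op m) = modRes M (homOfLE (h'.trans h)).op m :=
  resHom_resHom M.val.presheaf h h' m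

lemma modRes_self {U : T.Opens} (h : U ≤ U) (m : modSections M (op U)) :
    modRes M (homOfLE h).op m = m :=
  resHom_self M.val.presheaf h m

lemma modRes_smul {U V : T.Opens} (h : V ≤ U) (c : C.obj.obj (op U)) (m : modSections M (op U)) :
    modRes M (homOfLE h).op (c • m) = commRes C h c • modRes M (homOfLE h).op m :=
  M.val.map_smul (homOfLE h).op c m

lemma modRes_field_smul {U V : T.Opens} (h : V ≤ U) (a : k) (m : modSections M (op U)) :
    modRes M (homOfLE h).op (a • m) = a • modRes M (homOfLE h).op m := by
  have := modRes_smul M h (algebraMap k (C.obj.obj (op U)) a) m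
  rwa [AlgHom.commutes] at this

lemma isSheaf_modSections :
    Presieve.IsSheaf T.site (M.val.presheaf ⋙ forget AddCommGrpCat.{u}) :=
  isSheaf_forget ⟨M.val.presheaf, M.isSheaf⟩

/-- Sections of a sheaf of modules are determined locally. -/
lemma modSections_ext {V : T.Opens} {S : Sieve V} (hS : S ∈ T.site V)
    {m m' : modSections M (op V)} (h : ∀ (W : T.Opens) (h : W ≤ V), S (homOfLE h) →
      modRes M (homOfLE h).op m = modRes M (homOfLE h).op m') : m = m' :=
  (isSheafFor_iff_resMap.1 (isSheaf_modSections M _ hS)).1 m m' h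

/-- Derivations over `U` are families indexed by all `V ≤ U`, and their values glue because `M` is a
sheaf. Hence the sheafification in `derSheaf` adds nothing, and its sections are actual derivations.
-/
lemma isSheaf_derPresheaf : Presheaf.IsSheaf T.site (derPresheaf M) := by
  refine isSheaf_of_forget fun U S hS => isSheafFor_iff_resMap.2 ⟨fun x y h => ?_, fun x hx => ?_⟩
  · change derSections M U at x y
    refine Subtype.ext (funext fun V => Derivation.ext fun c => ?_)
    refine modSections_ext M (T.site.pullback_stable (homOfLE V.2) hS) fun W hW hWS => ?_
    have hx := x.2 V ⟨W, hW.trans V.2⟩ hW c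
    have hy := y.2 V ⟨W, hW.trans V.2⟩ hW c
    rw [← hx, ← hy]
    have := congrArg (fun z : derSections M W => z.1 ⟨W, le_rfl⟩) (h W (hW.trans V.2) hWS)
    exact congr($this _)
  · change ∀ (W : T.Opens) (h : W ≤ U), S (homOfLE h) → derSections M W at x
    have hx' (W W' : T.Opens) (h : W ≤ U) (h' : W' ≤ W) (hW : S (homOfLE h))
        (hW' : S (homOfLE (h'.trans h))) :
        (x W h hW).1 ⟨W', h'⟩ = (x W' (h'.trans h) hW').1 ⟨W', le_rfl⟩ :=
      congrArg (fun z : derSections M W' => z.1 ⟨W', le_rfl⟩) (hx W W' h h' hW hW')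
    have hpb (V : T.Opens) (hV : V ≤ U) := T.site.pullback_stable (homOfLE hV) hS
    -- The value on `c` over `V` is glued from the values of the local derivations on the
    -- restrictions of `c`, over the sieve pulled back to `V`. Additivity and the Leibniz rule are
    -- then local statements.
    have key (V : {V : T.Opens // V ≤ U}) (c : C.obj.obj (op V.1)) : ∃ m : modSections M (op V.1),
        ∀ (W : T.Opens) (hW : W ≤ V.1) (hWS : S (homOfLE (hW.trans V.2))),
          modRes M (homOfLE hW).op m = (x W (hW.trans V.2) hWS).1 ⟨W, le_rfl⟩ (commRes C hW c) := by
      refine (isSheafFor_iff_resMap.1 (isSheaf_modSections M _ (hpb V.1 V.2))).2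
        (fun W hW hWS => (x W (hW.trans V.2) hWS).1 ⟨W, le_rfl⟩ (commRes C hW c)) ?_
      intro W W' h h' hW hW'
      have h1 := (x W (h.trans V.2) hW).2 ⟨W, le_rfl⟩ ⟨W', h'⟩ h' (commRes C h c)
      refine h1.symm.trans ?_
      rw [hx' W W' (h.trans V.2) h' hW hW', ← commRes_commRes C h h']
      rfl
    choose y hy using key
    have hext (V : {V : T.Opens // V ≤ U}) {m m' : modSections M (op V.1)}
        (h : ∀ (W : T.Opens) (hW : W ≤ V.1), S (homOfLE (hW.trans V.2)) →
          modRes M (homOfLE hW).op m = modRes M (homOfLE hW).op m') : m = m' :=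
      modSections_ext M (hpb V.1 V.2) h
    let δ (V : {V : T.Opens // V ≤ U}) :
        Derivation k (C.obj.obj (op V.1)) (modSections M (op V.1)) :=
      Derivation.mk'
        { toFun := y V
          map_add' := fun c c' => hext V fun W hW hWS => by
            rw [map_add, hy V _ W hW hWS, hy V _ W hW hWS, hy V _ W hW hWS, map_add, map_add]
          map_smul' := fun a c => hext V fun W hW hWS => by
            rw [RingHom.id_apply, modRes_field_smul, hy V _ W hW hWS, hy V _ W hW hWS, map_smul]
            exact ((x W _ hWS).1 ⟨W, le_rfl⟩).toLinearMap.map_smul a _ }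
        (fun c c' => hext V fun W hW hWS => by
          change modRes M _ (y V (c * c')) = modRes M _ (c • y V c' + c' • y V c)
          rw [map_add, modRes_smul, modRes_smul, hy V _ W hW hWS, hy V _ W hW hWS,
            hy V _ W hW hWS, map_mul, Derivation.leibniz])
    have hδ : δ ∈ derSections M U := fun V V' h c => hext V' fun W hW hWS => by
      change modRes M _ (y V' (commRes C h c)) = modRes M _ (modRes M _ (y V c))
      rw [modRes_modRes, hy V' _ W hW hWS, hy V _ W (hW.trans h) hWS, commRes_commRes]
    refine ⟨(⟨δ, hδ⟩ : derSections M U), fun W h hWS => ?_⟩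
    refine Subtype.ext (funext fun V => Derivation.ext fun c => ?_)
    have hVS : S (homOfLE (V.2.trans h)) := S.downward_closed hWS (homOfLE V.2)
    change y ⟨V.1, V.2.trans h⟩ c = (x W h hWS).1 V c
    rw [hx' W V.1 h V.2 hWS hVS]
    have h1 := hy ⟨V.1, V.2.trans h⟩ c V.1 le_rfl hVS
    rw [modRes_self, commRes_self] at h1
    exact h1

lemma bijective_toSheafify_derPresheaf (U : T.Opens) :
    Function.Bijective ((toSheafify T.site (derPresheaf M)).app (op U)).hom :=
  bijective_toSheafify
    (isSheafBelow_of_isSheaf (isSheaf_forget ⟨_, isSheaf_derPresheaf M⟩) U) le_rfl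

/-- If `H¹(X, Der(C, M)) = 0`, then the `1`-cocycles of derivations of an admissible covering are
coboundaries. -/
theorem exists_derivation_coboundary [Subsingleton (Sheaf.H (derSheaf M) 1)]
    {𝒰 : Set (Set X)} (h𝒰 : T.IsCovOf T.whole 𝒰)
    (s : ∀ U V : {U : T.Opens // U.1 ∈ 𝒰}, derSections M (inter U.1 V.1))
    (hs : ∀ (U V U' : {U : T.Opens // U.1 ∈ 𝒰}) (W : T.Opens) (hU : W ≤ U.1) (hV : W ≤ V.1)
      (hU' : W ≤ U'.1) (c : C.obj.obj (op W)), (s U V).1 ⟨W, le_inter hU hV⟩ c +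
        (s V U').1 ⟨W, le_inter hV hU'⟩ c = (s U U').1 ⟨W, le_inter hU hU'⟩ c) :
    ∃ t : ∀ U : {U : T.Opens // U.1 ∈ 𝒰}, derSections M U.1,
      ∀ (U V : {U : T.Opens // U.1 ∈ 𝒰}) (W : T.Opens) (hU : W ≤ U.1) (hV : W ≤ V.1)
        (c : C.obj.obj (op W)), (t U).1 ⟨W, hU⟩ c - (t V).1 ⟨W, hV⟩ c =
          (s U V).1 ⟨W, le_inter hU hV⟩ c := by
  let η := toSheafify T.site (derPresheaf M)
  -- The cocycle is moved to the associated sheaf, where the cohomological hypothesis lives, and the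
  -- solution is brought back through the bijective unit.
  obtain ⟨t, ht⟩ := exists_coboundary (derSheaf M) h𝒰 (fun U V => (η.app _).hom (s U V)) (by
    intro U V U' W hU hV hU'
    have h : resHom (derPresheaf M) (le_inter hU hV) (s U V) +
        resHom (derPresheaf M) (le_inter hV hU') (s V U') =
          resHom (derPresheaf M) (le_inter hU hU') (s U U') :=
      Subtype.ext (funext fun W' => Derivation.ext fun c => hs U V U' W'.1 (W'.2.trans hU)
        (W'.2.trans hV) (W'.2.trans hU') c)
    have := congrArg (η.app (op W)).hom h
    rw [map_add] at this
    exact ((congrArg₂ (· + ·) (app_resHom η _ _) (app_resHom η _ _)).symm.trans this).trans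
      (app_resHom η _ _))
  choose t' ht' using fun U => (bijective_toSheafify_derPresheaf M U).2
  refine ⟨fun U => t' U.1 (t U), fun U V W hU hV c => ?_⟩
  have h : resHom (derPresheaf M) (inter_le_left U.1 V.1) (t' U.1 (t U)) -
      resHom (derPresheaf M) (inter_le_right U.1 V.1) (t' V.1 (t V)) = s U V := by
    apply (bijective_toSheafify_derPresheaf M (inter U.1 V.1)).1
    rw [map_sub]
    refine Eq.trans ?_ (ht U V)
    exact congrArg₂ (· - ·) ((app_resHom η _ _).trans (congrArg _ (ht' _ _)))
      ((app_resHom η _ _).trans (congrArg _ (ht' _ _)))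
  have h1 := congrArg (fun z : derSections M (inter U.1 V.1) => z.1 ⟨W, le_inter hU hV⟩) h
  exact congr($h1 c)

end Derivations

/-! ### Normal forms for classes in `R ⊗ (S_p / S_(p+1))` -/

section Projection

variable {k D : Type u} [Field k] [Ring D] [Algebra k D]

/-- The base change to `R` of a projection of `D` onto a complement of `S_{p + 1}` in `S_p`, where
`S_p` is `centralPow ε₀ p`. -/
noncomputable def grProj (ε₀ : D →ₐ[k] k) (p : ℕ) (R : Type u) [CommRing R] [Algebra k R] :
    R ⊗[k] D →ₗ[R] R ⊗[k] D :=
  (exists_centralPow_projection ε₀ p).choose.baseChange R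

variable {ε₀ : D →ₐ[k] k} {p : ℕ} {R : Type u} [CommRing R] [Algebra k R]

lemma grProj_mem (x : R ⊗[k] D) : grProj ε₀ p R x ∈ (centralPow ε₀ p).baseChange R :=
  LinearMap.baseChange_mem_baseChange _
    (fun s _ => (exists_centralPow_projection ε₀ p).choose_spec.1 s)
    (Submodule.mem_baseChange_top x)

lemma grProj_eq_zero {x : R ⊗[k] D} (hx : x ∈ (centralPow ε₀ (p + 1)).baseChange R) :
    grProj ε₀ p R x = 0 := by
  have := LinearMap.baseChange_mem_baseChange _ (S' := ⊥)
    (exists_centralPow_projection ε₀ p).choose_spec.2.1 hx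
  rwa [Submodule.baseChange_bot] at this

lemma grProj_sub_mem {x : R ⊗[k] D} (hx : x ∈ (centralPow ε₀ p).baseChange R) :
    grProj ε₀ p R x - x ∈ (centralPow ε₀ (p + 1)).baseChange R :=
  LinearMap.baseChange_sub_mem_baseChange _
    (exists_centralPow_projection ε₀ p).choose_spec.2.2.1 hx

lemma grProj_grProj (x : R ⊗[k] D) : grProj ε₀ p R (grProj ε₀ p R x) = grProj ε₀ p R x := by
  rw [grProj, ← LinearMap.comp_apply, ← LinearMap.baseChange_comp]
  congr 2
  exact LinearMap.ext (exists_centralPow_projection ε₀ p).choose_spec.2.2.2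

lemma grProj_naturality {R' : Type u} [CommRing R'] [Algebra k R'] (f : R →ₐ[k] R')
    (x : R ⊗[k] D) : Algebra.TensorProduct.map f (AlgHom.id k D) (grProj ε₀ p R x) =
      grProj ε₀ p R' (Algebra.TensorProduct.map f (AlgHom.id k D) x) :=
  Algebra.TensorProduct.map_id_baseChange f _ x

end Projection

/-! ### The centre and the powers of `I₀` in a trivialization -/

section Trivialization

variable {X : Type u} {T : GeneralizedTopology X} {k : Type u} [Field k]
  {A : Sheaf T.site (AlgCat.{u} k)} {C : Sheaf T.site (CommAlgCat.{u} k)}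
  {D : Type u} [Ring D] [Algebra k D] {ε₀ : D →ₐ[k] k} {ε : A ⟶ algSheaf C}

/-- The restriction maps of a sheaf of algebras. -/
def algRes (A : Sheaf T.site (AlgCat.{u} k)) {U V : T.Opens} (h : V ≤ U) :
    A.obj.obj (op U) →ₐ[k] A.obj.obj (op V) :=
  (A.obj.map (homOfLE h).op).hom

/-- The restriction maps of the centre of a sheaf of algebras. -/
def centerRes (A : Sheaf T.site (AlgCat.{u} k)) {U V : T.Opens} (h : V ≤ U) :
    centerSections A (op U) →ₐ[k] centerSections A (op V) :=
  ((centerPresheaf A).map (homOfLE h).op).hom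

lemma coe_centerRes {U V : T.Opens} (h : V ≤ U) (a : centerSections A (op U)) :
    (centerRes A h a : A.obj.obj (op V)) = algRes A h a := rfl

lemma isSheaf_algSections : Presieve.IsSheaf T.site (A.obj ⋙ forget (AlgCat.{u} k)) :=
  (isSheaf_iff_isSheaf_of_type _ _).1
    (Presheaf.isSheaf_comp_of_isSheaf T.site A.obj (forget (AlgCat.{u} k)) A.property)

/-- The restriction maps of `C ⊗ D`. -/
noncomputable abbrev tensRes (C : Sheaf T.site (CommAlgCat.{u} k)) (D : Type u) [Ring D]
    [Algebra k D] {U V : T.Opens} (h : V ≤ U) :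
    C.obj.obj (op U) ⊗[k] D →ₐ[k] C.obj.obj (op V) ⊗[k] D :=
  tensorRes C D (homOfLE h).op

namespace DTrivialization

variable {U V : T.Opens} (t : DTrivialization ε₀ ε U) (hV : V ≤ U)

lemma τ_algRes {W : T.Opens} (hW : W ≤ V) (a : A.obj.obj (op V)) :
    t.τ W (hW.trans hV) (algRes A hW a) = tensRes C D hW (t.τ V hV a) :=
  t.naturality V W hV hW a

lemma algRes_symm {W : T.Opens} (hW : W ≤ V) (x : C.obj.obj (op V) ⊗[k] D) :
    algRes A hW ((t.τ V hV).symm x) = (t.τ W (hW.trans hV)).symm (tensRes C D hW x) := by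
  apply (t.τ W (hW.trans hV)).injective
  rw [τ_algRes t hV, AlgEquiv.apply_symm_apply, AlgEquiv.apply_symm_apply]

include t in
/-- Sections of `C ⊗ D` below `U` are determined locally. -/
lemma tensor_ext {S : Sieve V} (hS : S ∈ T.site V) {x y : C.obj.obj (op V) ⊗[k] D}
    (hV : V ≤ U) (h : ∀ (W : T.Opens) (hW : W ≤ V), S (homOfLE hW) →
      tensRes C D hW x = tensRes C D hW y) : x = y := by
  -- Separatedness of `C ⊗ D` is borrowed from the sheaf `A` through `τ`.
  apply (t.τ V hV).symm.injective
  refine (isSheafFor_iff_resMap.1 (isSheaf_algSections (A := A) _ hS)).1 _ _ fun W hW hWS => ?_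
  change algRes A hW _ = algRes A hW _
  rw [algRes_symm, algRes_symm, h W hW hWS]

/-- A section of the centre must stay central under every restriction. It does, since restricting
the coefficients keeps an element of `C ⊗ S_p` in a subspace of the same form. -/
lemma symm_mem_centerSections {p : ℕ} {x : C.obj.obj (op V) ⊗[k] D}
    (hx : x ∈ (centralPow ε₀ p).baseChange (C.obj.obj (op V))) :
    (t.τ V hV).symm x ∈ centerSections A (op V) := by
  rw [mem_centerSections]
  intro W g
  induction W with | op W => ?_
  have hW : W ≤ V := leOfHom g.unop
  rw [Subalgebra.mem_center_iff]
  intro b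
  change b * algRes A hW _ = algRes A hW _ * b
  rw [algRes_symm]
  apply (t.τ W (hW.trans hV)).injective
  rw [map_mul, map_mul, AlgEquiv.apply_symm_apply]
  exact commute_of_mem_baseChange_centralPow
    (Algebra.TensorProduct.map_id_mem_baseChange (C.obj.map (homOfLE hW).op).hom hx) _

lemma τ_mul_comm (a : centerSections A (op V)) (y : C.obj.obj (op V) ⊗[k] D) :
    y * t.τ V hV a = t.τ V hV a * y := by
  have := mem_centerSections.1 a.2 _ (𝟙 _)
  rw [A.obj.map_id] at this
  have := congrArg (t.τ V hV) (Subalgebra.mem_center_iff.1 this ((t.τ V hV).symm y))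
  rw [map_mul, map_mul, AlgEquiv.apply_symm_apply] at this
  exact this

/-- The section `c ↦ τ⁻¹(c ⊗ 1)` of `Z(A) → C` given by a trivialization. -/
noncomputable def scalar : C.obj.obj (op V) →ₐ[k] centerSections A (op V) :=
  ((t.τ V hV).symm.toAlgHom.comp Algebra.TensorProduct.includeLeft).codRestrict _
    fun c => t.symm_mem_centerSections hV (p := 0) (ε₀ := ε₀)
      (Submodule.tmul_mem_baseChange_of_mem c (mem_centralPow_zero.2 (one_mem _)))

@[simp]
lemma τ_scalar (c : C.obj.obj (op V)) : t.τ V hV (t.scalar hV c) = c ⊗ₜ 1 :=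
  AlgEquiv.apply_symm_apply _ _

lemma centerRes_scalar {W : T.Opens} (hW : W ≤ V) (c : C.obj.obj (op V)) :
    centerRes A hW (t.scalar hV c) = t.scalar (hW.trans hV) (commRes C hW c) :=
  Subtype.ext (t.algRes_symm hV hW _)

lemma centerAug_scalar (c : C.obj.obj (op V)) :
    ((centerAug ε).hom.app (op V)).hom (t.scalar hV c) = c := by
  have := t.aug V hV (t.scalar hV c)
  rw [τ_scalar, idTensor_tmul, map_one, one_smul] at this
  exact this.symm

/-- The embedding `z ↦ τ⁻¹(1 ⊗ z)` of `Z(D)` into the centre of `A` given by a trivialization. -/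
noncomputable def centralConst : Subalgebra.center k D →ₐ[k] centerSections A (op V) :=
  ((t.τ V hV).symm.toAlgHom.comp (Algebra.TensorProduct.includeRight.comp
    (Subalgebra.center k D).val)).codRestrict _
    fun z => t.symm_mem_centerSections hV (p := 0) (ε₀ := ε₀)
      (Submodule.tmul_mem_baseChange_of_mem _ (mem_centralPow_zero.2 z.2))

lemma τ_centralConst (z : Subalgebra.center k D) :
    t.τ V hV (t.centralConst hV z) = 1 ⊗ₜ (z : D) :=
  AlgEquiv.apply_symm_apply _ _

lemma mem_augIdeal_iff {a : centerSections A (op V)} :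
    a ∈ augIdeal ε (op V) ↔ idTensor ε₀ _ (t.τ V hV a) = 0 := by
  rw [t.aug V hV a]
  exact Iff.rfl

/-- Induction on `p`: the centre of `C ⊗ D` lies in `C ⊗ S_0`, its elements of zero augmentation lie
in `C ⊗ S_1`, and the product of `S_p` and `S_1` lies in `S_(p+1)`. -/
lemma τ_mem_of_mem_augIdeal_pow {p : ℕ} {a : centerSections A (op V)}
    (ha : a ∈ augIdeal ε (op V) ^ p) :
    t.τ V hV a ∈ (centralPow ε₀ p).baseChange (C.obj.obj (op V)) := by
  induction p generalizing a with
  | zero => exact mem_baseChange_centralPow_zero (t.τ_mul_comm hV a)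
  | succ p ih =>
    rw [pow_succ] at ha
    induction ha using Submodule.mul_induction_on' with
    | mem_mul_mem a ha b hb =>
      have hb' := mem_baseChange_centralPow_one (t.τ_mul_comm hV b) ((t.mem_augIdeal_iff hV).1 hb)
      have := Submodule.mul_mem_baseChange (fun _ hs _ hs' => mul_mem_centralPow hs hs') (ih ha) hb'
      rw [← map_mul] at this
      exact this
    | add x _ y _ hx hy =>
      have := add_mem hx hy
      rw [← map_add] at this
      exact this

/-- The powers of `I₀ = ker ε ∩ Z(A)` in a trivialization. -/
lemma mem_augIdeal_pow_iff {p : ℕ} {a : centerSections A (op V)} :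
    a ∈ augIdeal ε (op V) ^ p ↔
      t.τ V hV a ∈ (centralPow ε₀ p).baseChange (C.obj.obj (op V)) := by
  refine ⟨t.τ_mem_of_mem_augIdeal_pow hV, fun h => ?_⟩
  -- A generator `c ⊗ z` comes from the product of `scalar c` and `centralConst z`. The ring
  -- homomorphism `centralConst` takes `Z(D) ∩ ker ε₀` into `I₀`, hence `p`th powers into `p`th
  -- powers.
  obtain ⟨b, hb, hba⟩ : ∃ b ∈ augIdeal ε (op V) ^ p, t.τ V hV b = t.τ V hV a := by
    refine Submodule.baseChange_induction
      (P := fun x => ∃ b ∈ augIdeal ε (op V) ^ p, t.τ V hV b = x)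
      ⟨0, zero_mem _, map_zero _⟩ ?_ ?_ h
    · rintro _ _ ⟨b, hb, rfl⟩ ⟨b', hb', rfl⟩
      exact ⟨b + b', add_mem hb hb', map_add _ _ _⟩
    · intro c s hs
      obtain ⟨z, hz, rfl⟩ := mem_centralPow.1 hs
      have hle : RingHom.ker (ε₀.comp (Subalgebra.center k D).val) ≤
          (augIdeal ε (op V)).comap (t.centralConst hV).toRingHom := by
        intro z hz
        refine (t.mem_augIdeal_iff hV).2 ?_
        change idTensor ε₀ _ (t.τ V hV (t.centralConst hV z)) = 0
        have hz : ε₀ z = 0 := hz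
        rw [τ_centralConst, idTensor_tmul, hz, zero_smul]
      have hz' : t.centralConst hV z ∈ augIdeal ε (op V) ^ p :=
        Ideal.pow_right_mono (Ideal.map_le_iff_le_comap.2 hle) p
          (Ideal.map_pow (t.centralConst hV).toRingHom _ p ▸ Ideal.mem_map_of_mem _ hz)
      refine ⟨t.scalar hV c * t.centralConst hV z, Ideal.mul_mem_left _ _ hz', ?_⟩
      refine (map_mul (t.τ V hV) _ _).trans ?_
      rw [τ_scalar, τ_centralConst, Algebra.TensorProduct.tmul_mul_tmul, mul_one, one_mul]
  have : b = a := Subtype.ext ((t.τ V hV).injective hba)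
  exact this ▸ hb

/-- A section of the centre with prescribed image in a trivialization. -/
lemma exists_mem_augIdeal_pow {p : ℕ} {x : C.obj.obj (op V) ⊗[k] D}
    (hx : x ∈ (centralPow ε₀ p).baseChange (C.obj.obj (op V))) :
    ∃ a ∈ augIdeal ε (op V) ^ p, t.τ V hV a = x := by
  refine ⟨⟨(t.τ V hV).symm x, t.symm_mem_centerSections hV hx⟩, ?_, ?_⟩
  · rw [t.mem_augIdeal_pow_iff hV]
    exact (AlgEquiv.apply_symm_apply (t.τ V hV) x).symm ▸ hx
  · exact AlgEquiv.apply_symm_apply _ _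

end DTrivialization

/-! ### The quotients `I₀ ^ p / I₀ ^ (p + 1)` over trivializing open sets -/

section Graded

variable {R : Type u} [CommRing R] {I : Ideal R} {p : ℕ}

/-- The class of an element of `I ^ p` in `I ^ p / I ^ (p + 1)`. -/
def IdealGr.mk {a : R} (ha : a ∈ I ^ p) : IdealGr I p := Submodule.Quotient.mk ⟨a, ha⟩

lemma IdealGr.mk_eq_mk_iff {a b : R} (ha : a ∈ I ^ p) (hb : b ∈ I ^ p) :
    IdealGr.mk ha = IdealGr.mk hb ↔ a - b ∈ I ^ (p + 1) := by
  rw [IdealGr.mk, IdealGr.mk, Submodule.Quotient.eq, Submodule.mem_smul_top_iff, smul_eq_mul,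
    ← pow_succ']
  rfl

lemma IdealGr.exists_mk (x : IdealGr I p) : ∃ (a : R) (ha : a ∈ I ^ p), IdealGr.mk ha = x := by
  obtain ⟨⟨a, ha⟩, rfl⟩ := Submodule.Quotient.mk_surjective _ x
  exact ⟨a, ha, rfl⟩

end Graded

section GradedSheaf

variable {U V : T.Opens} {p : ℕ}

lemma centerRes_mem_augIdeal_pow {W : T.Opens} (h : W ≤ V) {a : centerSections A (op V)}
    (ha : a ∈ augIdeal ε (op V) ^ p) : centerRes A h a ∈ augIdeal ε (op W) ^ p :=
  Ideal.pow_right_mono (Ideal.map_le_iff_le_comap.2 (augIdeal_le_comap ε (homOfLE h).op)) p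
    (Ideal.map_pow (centerRes A h).toRingHom _ p ▸ Ideal.mem_map_of_mem _ ha)

lemma grAbPresheaf_map_mk {W : T.Opens} (h : W ≤ V) {a : centerSections A (op V)}
    (ha : a ∈ augIdeal ε (op V) ^ p) :
    resHom (grAbPresheaf ε p) h (IdealGr.mk ha) =
      IdealGr.mk (centerRes_mem_augIdeal_pow h ha) :=
  IdealGr.map_mk _ (augIdeal_le_comap ε _) p ⟨a, ha⟩ ⟨_, centerRes_mem_augIdeal_pow h ha⟩ rfl

/-- Below `U`, the presheaf `I₀ ^ p / I₀ ^ (p + 1)` satisfies the sheaf condition if `A` is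
trivial over `U`. -/
lemma DTrivialization.isSheafBelow_grAbPresheaf (t : DTrivialization ε₀ ε U) (p : ℕ) :
    IsSheafBelow (grAbPresheaf ε p ⋙ forget AddCommGrpCat.{u}) U := by
  intro V hV S hS
  refine isSheafFor_iff_resMap.2 ⟨fun x y h => ?_, fun x hx => ?_⟩
  · obtain ⟨a, ha, rfl⟩ := IdealGr.exists_mk (x : IdealGr (augIdeal ε (op V)) p)
    obtain ⟨b, hb, rfl⟩ := IdealGr.exists_mk (y : IdealGr (augIdeal ε (op V)) p)
    refine (IdealGr.mk_eq_mk_iff ha hb).2 ((t.mem_augIdeal_pow_iff hV).2 ?_)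
    -- A class is zero exactly when the normal form of a representative is zero, and that is an
    -- equality in `C ⊗ D`, which can be checked locally.
    have h0 : grProj ε₀ p _ (t.τ V hV (a - b : centerSections A (op V))) = 0 := by
      refine t.tensor_ext hS hV fun W hW hWS => ?_
      have h1 := h W hW hWS
      have h2 := (IdealGr.mk_eq_mk_iff (centerRes_mem_augIdeal_pow hW ha)
        (centerRes_mem_augIdeal_pow hW hb)).1 ((grAbPresheaf_map_mk hW ha).symm.trans
          (h1.trans (grAbPresheaf_map_mk hW hb)))
      rw [← map_sub, t.mem_augIdeal_pow_iff (hW.trans hV), coe_centerRes, τ_algRes t hV] at h2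
      rw [map_zero]
      exact (grProj_naturality _ _).trans (grProj_eq_zero h2)
    have := grProj_sub_mem
      ((t.mem_augIdeal_pow_iff hV).1 (sub_mem ha hb))
    rw [h0, zero_sub] at this
    exact neg_mem_iff.1 this
  · choose a ha hax using fun W h hW =>
      IdealGr.exists_mk (x W h hW : IdealGr (augIdeal ε (op W)) p)
    -- Arbitrary representatives agree only modulo `I₀ ^ (p + 1)` and need not glue. Their normal
    -- forms depend only on the classes, so they agree exactly and glue in `A`.
    let y (W : T.Opens) (h : W ≤ V) (hW : S (homOfLE h)) : C.obj.obj (op W) ⊗[k] D :=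
      grProj ε₀ p _ (t.τ W (h.trans hV) (a W h hW))
    obtain ⟨z, hz⟩ := (isSheafFor_iff_resMap.1 (isSheaf_algSections (A := A) _ hS)).2
      (fun W h hW => (t.τ W (h.trans hV)).symm (y W h hW)) (by
        intro W W' h h' hW hW'
        refine (t.algRes_symm (h.trans hV) h' _).trans (congrArg _ ?_)
        refine (grProj_naturality _ _).trans ?_
        have h1 := hx W W' h h' hW hW'
        rw [← hax, ← hax] at h1
        have h2 := (IdealGr.mk_eq_mk_iff (centerRes_mem_augIdeal_pow h' (ha W h hW)) _).1
          ((grAbPresheaf_map_mk h' (ha W h hW)).symm.trans h1)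
        rw [t.mem_augIdeal_pow_iff ((h'.trans h).trans hV)] at h2
        have h3 := grProj_eq_zero h2
        change grProj ε₀ p _ (t.τ W' _ (algRes A h' (a W h hW) - (a W' _ hW' : A.obj.obj _))) = 0
          at h3
        rw [map_sub, map_sub, sub_eq_zero, τ_algRes t (h.trans hV)] at h3
        exact h3)
    have hz' (W : T.Opens) (h : W ≤ V) (hW : S (homOfLE h)) :
        tensRes C D h (t.τ V hV z) = y W h hW := by
      rw [← τ_algRes]
      exact (congrArg _ (hz W h hW)).trans (AlgEquiv.apply_symm_apply _ _)
    -- The glued section is again in normal form. This places it in `C ⊗ S_p` and hence in `I₀ ^ p`,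
    -- which local membership alone would not show.
    have hπz : grProj ε₀ p _ (t.τ V hV z) = t.τ V hV z := by
      refine t.tensor_ext hS hV fun W h hW => ?_
      refine (grProj_naturality _ _).trans ?_
      change grProj ε₀ p _ (tensRes C D h _) = _
      rw [hz' W h hW]
      exact grProj_grProj _
    obtain ⟨b, hb, hbz⟩ := t.exists_mem_augIdeal_pow hV (grProj_mem (t.τ V hV z))
    rw [hπz] at hbz
    refine ⟨IdealGr.mk hb, fun W h hW => (grAbPresheaf_map_mk h hb).trans ?_⟩
    rw [← hax W h hW]
    refine (IdealGr.mk_eq_mk_iff _ (ha W h hW)).2 ((t.mem_augIdeal_pow_iff (h.trans hV)).2 ?_)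
    change t.τ W _ (algRes A h b - (a W h hW : A.obj.obj _)) ∈ _
    rw [map_sub, τ_algRes t hV, hbz, hz' W h hW]
    exact grProj_sub_mem ((t.mem_augIdeal_pow_iff (h.trans hV)).1 (ha W h hW))

end GradedSheaf

end Trivialization

/-! ### Lifting derivations and modifying trivializations -/

section ToSheaf

variable {X : Type u} {T : GeneralizedTopology X} {k : Type u} [Field k]
  {A : Sheaf T.site (AlgCat.{u} k)} {C : Sheaf T.site (CommAlgCat.{u} k)}
  {D : Type u} [Ring D] [Algebra k D] {ε₀ : D →ₐ[k] k} {ε : A ⟶ algSheaf C}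

instance (M : SheafOfModules.{u} (ringSheaf C)) (U : T.Opensᵒᵖ) :
    IsScalarTower k (C.obj.obj U) (modSections M U) where
  smul_assoc a c m := by
    rw [Algebra.smul_def, mul_smul]
    rfl

/-- The map from `I₀ ^ p / I₀ ^ (p + 1)` to the sections of the associated sheaf of modules. -/
noncomputable def grToSheaf (hA : IsRingedDSpace ε₀ ε) (p : ℕ) (V : T.Opens) :
    IdealGr (augIdeal ε (op V)) p →+ modSections (grSheaf hA p) (op V) :=
  ((toSheafify T.site (grAbPresheaf ε p)).app (op V)).hom

variable (hA : IsRingedDSpace ε₀ ε) {p : ℕ} {U V : T.Opens}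

lemma modRes_grToSheaf {W : T.Opens} (h : W ≤ V) {a : centerSections A (op V)}
    (ha : a ∈ augIdeal ε (op V) ^ p) :
    modRes (grSheaf hA p) (homOfLE h).op (grToSheaf hA p V (IdealGr.mk ha)) =
      grToSheaf hA p W (IdealGr.mk (centerRes_mem_augIdeal_pow h ha)) := by
  rw [← grAbPresheaf_map_mk h ha]
  exact (app_resHom (toSheafify T.site (grAbPresheaf ε p)) h _).symm

/-- The unit of the sheafification is linear over `Z(A) / I₀ → C`, so a central section acts through
its augmentation. -/
lemma grToSheaf_mk_mul (r : centerSections A (op V)) {a : centerSections A (op V)}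
    (ha : a ∈ augIdeal ε (op V) ^ p) :
    grToSheaf hA p V (IdealGr.mk (Ideal.mul_mem_left _ r ha)) =
      ((((centerAug ε).hom.app (op V)).hom r : C.obj.obj (op V)) •
        grToSheaf hA p V (IdealGr.mk ha) : modSections (grSheaf hA p) (op V)) := by
  have := hA.isLocallySurjective
  exact ((PresheafOfModules.toSheafify (quotAug ε)
    (toSheafify T.site (grPresheaf ε p).presheaf)).app (op V)).hom.map_smul
    (Ideal.Quotient.mk (augIdeal ε (op V)) r) (IdealGr.mk ha)

/-- A map `C → Z(A)` on sections. -/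
noncomputable def centralVal (φ : C ⟶ centerSheaf A) (V : T.Opens) :
    C.obj.obj (op V) →ₐ[k] centerSections A (op V) :=
  (φ.hom.app (op V)).hom

lemma centerRes_centralVal (φ : C ⟶ centerSheaf A) {W : T.Opens} (h : W ≤ V)
    (c : C.obj.obj (op V)) :
    centerRes A h (centralVal φ V c) = centralVal φ W (commRes C h c) :=
  congr(($(φ.hom.naturality (homOfLE h).op)).hom c).symm

/-- The restriction of `ε` to the centre, on sections. -/
noncomputable def augVal (ε : A ⟶ algSheaf C) (V : T.Opens) :
    centerSections A (op V) →ₐ[k] C.obj.obj (op V) :=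
  ((centerAug ε).hom.app (op V)).hom

lemma augVal_centralVal {φ : C ⟶ centerSheaf A} (hφ : φ ≫ centerAug ε = 𝟙 C)
    (c : C.obj.obj (op V)) : augVal ε V (centralVal φ V c) = c :=
  congr(($(hφ).hom.app (op V)).hom c)

namespace DTrivialization

variable (t : DTrivialization ε₀ ε U) (hV : V ≤ U)

lemma τ_add (a b : centerSections A (op V)) :
    t.τ V hV (a + b : centerSections A (op V)) = t.τ V hV a + t.τ V hV b :=
  map_add (t.τ V hV) _ _

lemma τ_sub (a b : centerSections A (op V)) :
    t.τ V hV (a - b : centerSections A (op V)) = t.τ V hV a - t.τ V hV b :=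
  map_sub (t.τ V hV) _ _

lemma τ_mul (a b : centerSections A (op V)) :
    t.τ V hV (a * b : centerSections A (op V)) = t.τ V hV a * t.τ V hV b :=
  map_mul (t.τ V hV) _ _

-- Over a trivializing open set the presheaf satisfies the sheaf condition, so sections of the
-- associated sheaf are classes of sections of `I₀ ^ p` there.
include t hV in
lemma bijective_grToSheaf : Function.Bijective (grToSheaf hA p V) :=
  bijective_toSheafify (t.isSheafBelow_grAbPresheaf p) hV

include t hV in
lemma exists_grToSheaf_eq (m : modSections (grSheaf hA p) (op V)) :
    ∃ (a : centerSections A (op V)) (ha : a ∈ augIdeal ε (op V) ^ p),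
      grToSheaf hA p V (IdealGr.mk ha) = m := by
  obtain ⟨x, rfl⟩ := (t.bijective_grToSheaf hA hV).2 m
  obtain ⟨a, ha, rfl⟩ := IdealGr.exists_mk x
  exact ⟨a, ha, rfl⟩

include t hV in
lemma grToSheaf_eq_iff {a b : centerSections A (op V)} (ha : a ∈ augIdeal ε (op V) ^ p)
    (hb : b ∈ augIdeal ε (op V) ^ p) :
    grToSheaf hA p V (IdealGr.mk ha) = grToSheaf hA p V (IdealGr.mk hb) ↔
      a - b ∈ augIdeal ε (op V) ^ (p + 1) := by
  rw [(t.bijective_grToSheaf hA hV).1.eq_iff, IdealGr.mk_eq_mk_iff]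

lemma grProj_eq_of_grToSheaf_eq {a b : centerSections A (op V)} (ha : a ∈ augIdeal ε (op V) ^ p)
    (hb : b ∈ augIdeal ε (op V) ^ p)
    (h : grToSheaf hA p V (IdealGr.mk ha) = grToSheaf hA p V (IdealGr.mk hb)) :
    grProj ε₀ p _ (t.τ V hV a) = grProj ε₀ p _ (t.τ V hV b) := by
  rw [t.grToSheaf_eq_iff hA hV, t.mem_augIdeal_pow_iff hV] at h
  have := grProj_eq_zero h
  rwa [τ_sub, map_sub, sub_eq_zero] at this

/-- A splitting of `I₀ ^ p → I₀ ^ p / I₀ ^ (p + 1)` over the open set `V`, in a trivialization. -/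
noncomputable def grLiftFun (m : modSections (grSheaf hA p) (op V)) : C.obj.obj (op V) ⊗[k] D :=
  grProj ε₀ p _ (t.τ V hV (t.exists_grToSheaf_eq hA hV m).choose)

/-- The chosen representative is irrelevant, because the projection kills `C ⊗ S_(p+1)`. -/
lemma grLiftFun_mk {a : centerSections A (op V)} (ha : a ∈ augIdeal ε (op V) ^ p) :
    t.grLiftFun hA hV (grToSheaf hA p V (IdealGr.mk ha)) = grProj ε₀ p _ (t.τ V hV a) := by
  obtain ⟨hb, h⟩ := (t.exists_grToSheaf_eq hA hV (grToSheaf hA p V (IdealGr.mk ha))).choose_spec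
  exact t.grProj_eq_of_grToSheaf_eq hA hV hb ha h

lemma grToSheaf_mk_scalar_mul (c : C.obj.obj (op V)) {a : centerSections A (op V)}
    (ha : a ∈ augIdeal ε (op V) ^ p) :
    grToSheaf hA p V (IdealGr.mk (Ideal.mul_mem_left _ (t.scalar hV c) ha)) =
      c • grToSheaf hA p V (IdealGr.mk ha) :=
  (grToSheaf_mk_mul hA (t.scalar hV c) ha).trans
    (congrArg (· • grToSheaf hA p V (IdealGr.mk ha)) (t.centerAug_scalar hV c))

lemma grLiftFun_add (m m' : modSections (grSheaf hA p) (op V)) :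
    t.grLiftFun hA hV (m + m') = t.grLiftFun hA hV m + t.grLiftFun hA hV m' := by
  obtain ⟨a, ha, rfl⟩ := t.exists_grToSheaf_eq hA hV m
  obtain ⟨b, hb, rfl⟩ := t.exists_grToSheaf_eq hA hV m'
  have h : grToSheaf hA p V (IdealGr.mk (add_mem ha hb)) =
      grToSheaf hA p V (IdealGr.mk ha) + grToSheaf hA p V (IdealGr.mk hb) :=
    map_add (grToSheaf hA p V) (IdealGr.mk ha) (IdealGr.mk hb)
  rw [← h, grLiftFun_mk, grLiftFun_mk, grLiftFun_mk, τ_add]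
  exact map_add (grProj ε₀ p _) _ _

lemma grLiftFun_smul (c : C.obj.obj (op V)) (m : modSections (grSheaf hA p) (op V)) :
    t.grLiftFun hA hV (c • m) = c • t.grLiftFun hA hV m := by
  obtain ⟨a, ha, rfl⟩ := t.exists_grToSheaf_eq hA hV m
  have h : t.τ V hV (t.scalar hV c * a : centerSections A (op V)) = c • t.τ V hV a := by
    rw [τ_mul, τ_scalar]
    exact (Algebra.smul_def c (t.τ V hV a)).symm
  rw [← t.grToSheaf_mk_scalar_mul hA hV, grLiftFun_mk, grLiftFun_mk, h]
  exact (grProj ε₀ p _).map_smul c _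

/-- A `C`-linear splitting of `I₀ ^ p → I₀ ^ p / I₀ ^ (p + 1)` in a trivialization. -/
noncomputable def grLift :
    modSections (grSheaf hA p) (op V) →ₗ[C.obj.obj (op V)] C.obj.obj (op V) ⊗[k] D where
  toFun := t.grLiftFun hA hV
  map_add' m m' := t.grLiftFun_add hA hV m m'
  map_smul' c m := t.grLiftFun_smul hA hV c m

lemma grLift_mk {a : centerSections A (op V)} (ha : a ∈ augIdeal ε (op V) ^ p) :
    t.grLift hA hV (grToSheaf hA p V (IdealGr.mk ha)) = grProj ε₀ p _ (t.τ V hV a) :=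
  t.grLiftFun_mk hA hV ha

lemma grLift_mem (m : modSections (grSheaf hA p) (op V)) :
    t.grLift hA hV m ∈ (centralPow ε₀ p).baseChange (C.obj.obj (op V)) :=
  grProj_mem _

lemma grLift_modRes {W : T.Opens} (hW : W ≤ V) (m : modSections (grSheaf hA p) (op V)) :
    t.grLift hA (hW.trans hV) (modRes (grSheaf hA p) (homOfLE hW).op m) =
      tensRes C D hW (t.grLift hA hV m) := by
  obtain ⟨a, ha, rfl⟩ := t.exists_grToSheaf_eq hA hV m
  rw [modRes_grToSheaf, grLift_mk, grLift_mk, coe_centerRes, t.τ_algRes hV]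
  exact (grProj_naturality _ _).symm

/-- `grLift` is a splitting. -/
lemma grToSheaf_eq_of_grLift {a : centerSections A (op V)} (ha : a ∈ augIdeal ε (op V) ^ p)
    {m : modSections (grSheaf hA p) (op V)}
    (h : t.τ V hV a - t.grLift hA hV m ∈ (centralPow ε₀ (p + 1)).baseChange (C.obj.obj (op V))) :
    grToSheaf hA p V (IdealGr.mk ha) = m := by
  obtain ⟨b, hb, rfl⟩ := t.exists_grToSheaf_eq hA hV m
  rw [t.grToSheaf_eq_iff hA hV, t.mem_augIdeal_pow_iff hV]
  rw [grLift_mk] at h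
  have := add_mem h (grProj_sub_mem ((t.mem_augIdeal_pow_iff hV).1 hb))
  rw [sub_add_sub_cancel, ← map_sub] at this
  exact this

section Exp

variable [CharZero k] (hJ : IsNilpotent (RingHom.ker ε₀)) (hp : 1 ≤ p)
  (δ : ∀ V : {V : T.Opens // V ≤ U},
    Derivation k (C.obj.obj (op V.1)) (C.obj.obj (op V.1) ⊗[k] D))
  (hδ : ∀ V c, δ V c ∈ (centralPow ε₀ p).baseChange (C.obj.obj (op V.1)))
  (hnat : ∀ (V W : {V : T.Opens // V ≤ U}) (h : W.1 ≤ V.1) (c : C.obj.obj (op V.1)),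
    δ W (commRes C h c) = tensRes C D h (δ V c))

/-- The composition of a trivialization with the exponential of a derivation. -/
noncomputable def compExp : DTrivialization ε₀ ε U where
  τ V hV := (t.τ V hV).trans (expEquiv hJ hp (hδ ⟨V, hV⟩))
  naturality V W hV hW a := by
    change expEquiv hJ hp (hδ ⟨W, hW.trans hV⟩) (t.τ W _ (algRes A hW a)) =
      tensRes C D hW (expEquiv hJ hp (hδ ⟨V, hV⟩) (t.τ V hV a))
    rw [t.τ_algRes hV]
    exact expEquiv_naturality hJ hp _ _ (commRes C hW) (hnat ⟨V, hV⟩ ⟨W, hW.trans hV⟩ hW) _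
  aug V hV a := (idTensor_expEquiv hJ hp (hδ ⟨V, hV⟩) _).trans (t.aug V hV a)

/-- The section of the new trivialization involves the inverse of the exponential, whence the change
by `-δ` to first order. -/
lemma τ_scalar_compExp (c : C.obj.obj (op V)) :
    t.τ V hV ((t.compExp hJ hp δ hδ hnat).scalar hV c) - t.τ V hV (t.scalar hV c) +
      δ ⟨V, hV⟩ c ∈ (centralPow ε₀ (p + 1)).baseChange (C.obj.obj (op V)) := by
  have h : t.τ V hV ((t.compExp hJ hp δ hδ hnat).scalar hV c) =
      (expEquiv hJ hp (hδ ⟨V, hV⟩)).symm (c ⊗ₜ 1) :=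
    AlgEquiv.apply_symm_apply (t.τ V hV) _
  rw [h, τ_scalar]
  exact expEquiv_symm_tmul_one hJ hp (hδ ⟨V, hV⟩) c

end Exp

section Central

variable (hJ : IsNilpotent (RingHom.ker ε₀)) (φ : C ⟶ centerSheaf A)
  (hφ : φ ≫ centerAug ε = 𝟙 C)

/-- A map `C → Z(A)` in a trivialization. -/
noncomputable def centralTens : C.obj.obj (op V) →ₐ[k] C.obj.obj (op V) ⊗[k] D :=
  (t.τ V hV).toAlgHom.comp ((centerSections A (op V)).val.comp (centralVal φ V))

lemma centralTens_apply (c : C.obj.obj (op V)) :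
    t.centralTens hV φ c = t.τ V hV (centralVal φ V c) := rfl

-- Both `φ(c)` and the scalar section of the trivialization have augmentation `c`, so they differ by
-- an element of `I₀`.
include hφ in
lemma centralTens_sub_mem (c : C.obj.obj (op V)) : t.centralTens hV φ c - c ⊗ₜ 1 ∈
    (centralPow ε₀ 1).baseChange (C.obj.obj (op V)) := by
  have h : centralVal φ V c - t.scalar hV c ∈ augIdeal ε (op V) ^ 1 := by
    rw [pow_one]
    change augVal ε V (centralVal φ V c - t.scalar hV c) = 0
    rw [map_sub, augVal_centralVal hφ]
    exact sub_eq_zero.2 (t.centerAug_scalar hV c).symm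
  have := (t.mem_augIdeal_pow_iff hV).1 h
  rwa [τ_sub, τ_scalar] at this

/-- The automorphism of `C ⊗ D` given by a map `C → Z(A)` in a trivialization. -/
noncomputable def centralEquiv : C.obj.obj (op V) ⊗[k] D ≃ₐ[k] C.obj.obj (op V) ⊗[k] D :=
  centralLift hJ (t.centralTens_sub_mem hV φ hφ)

lemma centralEquiv_tmul_one (c : C.obj.obj (op V)) :
    t.centralEquiv hV hJ φ hφ (c ⊗ₜ 1) = t.τ V hV (centralVal φ V c) := by
  refine (centralLiftHom_tmul (t.centralTens_sub_mem hV φ hφ) c 1).trans ?_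
  rw [← Algebra.TensorProduct.one_def, mul_one, centralTens_apply]

lemma idTensor_centralEquiv (x : C.obj.obj (op V) ⊗[k] D) :
    idTensor ε₀ _ (t.centralEquiv hV hJ φ hφ x) = idTensor ε₀ _ x :=
  idTensor_centralLiftHom (t.centralTens_sub_mem hV φ hφ) x

lemma centralEquiv_tensRes {W : T.Opens} (hW : W ≤ V) (x : C.obj.obj (op V) ⊗[k] D) :
    t.centralEquiv (hW.trans hV) hJ φ hφ (tensRes C D hW x) =
      tensRes C D hW (t.centralEquiv hV hJ φ hφ x) := by
  refine centralLiftHom_naturality (t.centralTens_sub_mem hV φ hφ)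
    (t.centralTens_sub_mem (hW.trans hV) φ hφ) (commRes C hW) (fun c => ?_) x
  rw [centralTens_apply, centralTens_apply, ← centerRes_centralVal, coe_centerRes, t.τ_algRes hV]
  rfl

/-- The trivialization in which the section `φ : C → Z(A)` becomes `c ↦ c ⊗ 1`. -/
noncomputable def ofCentral : DTrivialization ε₀ ε U where
  τ V hV := (t.τ V hV).trans (t.centralEquiv hV hJ φ hφ).symm
  naturality V W hV hW a := by
    change (t.centralEquiv (hW.trans hV) hJ φ hφ).symm (t.τ W _ (algRes A hW a)) =
      tensRes C D hW ((t.centralEquiv hV hJ φ hφ).symm (t.τ V hV a))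
    rw [AlgEquiv.symm_apply_eq, t.centralEquiv_tensRes hV, AlgEquiv.apply_symm_apply, t.τ_algRes hV]
  aug V hV a := by
    change idTensor ε₀ _ ((t.centralEquiv hV hJ φ hφ).symm (t.τ V hV a)) = _
    rw [← t.idTensor_centralEquiv hV hJ φ hφ, AlgEquiv.apply_symm_apply]
    exact t.aug V hV a

lemma τ_ofCentral (c : C.obj.obj (op V)) :
    (t.ofCentral hJ φ hφ).τ V hV (centralVal φ V c) = c ⊗ₜ 1 :=
  (AlgEquiv.symm_apply_eq _).2 (t.centralEquiv_tmul_one hV hJ φ hφ c).symm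

/-- The isomorphism of sheaves of `C`-modules underlying `ofCentral`. -/
noncomputable def moduleTrivialization : ModuleTrivialization (moduleOfCentral φ) D U where
  σ V hV :=
    { ((t.ofCentral hJ φ hφ).τ V hV).toAddEquiv with
      map_smul' := fun c (a : A.obj.obj (op V)) => by
        have h : (t.ofCentral hJ φ hφ).τ V hV ((centralVal φ V c : A.obj.obj (op V)) * a) =
            c • (t.ofCentral hJ φ hφ).τ V hV a := by
          rw [map_mul, τ_ofCentral]
          exact (Algebra.smul_def c ((t.ofCentral hJ φ hφ).τ V hV a)).symm
        exact h }
  naturality V W hV hW a := (t.ofCentral hJ φ hφ).naturality V W hV hW a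

end Central

end DTrivialization

end ToSheaf

/-! ### Successive approximation and glueing of the local sections -/

section Glueing

variable {X : Type u} {T : GeneralizedTopology X} {k : Type u} [Field k]
  {A : Sheaf T.site (AlgCat.{u} k)} {C : Sheaf T.site (CommAlgCat.{u} k)}
  {D : Type u} [Ring D] [Algebra k D] {ε₀ : D →ₐ[k] k} {ε : A ⟶ algSheaf C}
  {𝒰 : Set (Set X)}

/-- The sections `C → Z(A)` given by local trivializations agree modulo `I₀ ^ p`. -/
def AgreeModPow (t : ∀ U : {U : T.Opens // U.1 ∈ 𝒰}, DTrivialization ε₀ ε U.1) (p : ℕ) : Prop :=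
  ∀ (U V : {U : T.Opens // U.1 ∈ 𝒰}) (W : T.Opens) (hU : W ≤ U.1) (hV : W ≤ V.1)
    (c : C.obj.obj (op W)),
    (t U).scalar hU c - (t V).scalar hV c ∈ augIdeal ε (op W) ^ p

/-- The induction starts here: two sections of `ε` differ by elements of its kernel. -/
lemma agreeModPow_one (t : ∀ U : {U : T.Opens // U.1 ∈ 𝒰}, DTrivialization ε₀ ε U.1) :
    AgreeModPow t 1 := by
  intro U V W hU hV c
  rw [pow_one]
  change augVal ε W ((t U).scalar hU c - (t V).scalar hV c) = 0
  rw [map_sub]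
  exact sub_eq_zero.2 (((t U).centerAug_scalar hU c).trans ((t V).centerAug_scalar hV c).symm)

variable (hA : IsRingedDSpace ε₀ ε) {p : ℕ}
  {t : ∀ U : {U : T.Opens // U.1 ∈ 𝒰}, DTrivialization ε₀ ε U.1}

/-- Rewriting a representative under `IdealGr.mk` is blocked by the membership proof that depends on
it. -/
lemma grToSheaf_congr {V : T.Opens} {a b : centerSections A (op V)}
    (ha : a ∈ augIdeal ε (op V) ^ p) (h : a = b) :
    grToSheaf hA p V (IdealGr.mk ha) = grToSheaf hA p V (IdealGr.mk (h ▸ ha)) := by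
  subst h
  rfl

lemma grToSheaf_mk_add {V : T.Opens} {a b : centerSections A (op V)}
    (ha : a ∈ augIdeal ε (op V) ^ p) (hb : b ∈ augIdeal ε (op V) ^ p) :
    grToSheaf hA p V (IdealGr.mk (add_mem ha hb)) =
      grToSheaf hA p V (IdealGr.mk ha) + grToSheaf hA p V (IdealGr.mk hb) :=
  map_add (grToSheaf hA p V) (IdealGr.mk ha) (IdealGr.mk hb)

/-- The class modulo `I₀ ^ (p + 1)` of the difference of two sections `C → Z(A)` over `W`. -/
noncomputable def diffDer (h : AgreeModPow t p) (U V : {U : T.Opens // U.1 ∈ 𝒰}) (W : T.Opens)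
    (hU : W ≤ U.1) (hV : W ≤ V.1) :
    Derivation k (C.obj.obj (op W)) (modSections (grSheaf hA p) (op W)) :=
  Derivation.mk'
    { toFun := fun c => grToSheaf hA p W (IdealGr.mk (h U V W hU hV c))
      map_add' := fun c c' => by
        rw [← grToSheaf_mk_add]
        exact grToSheaf_congr hA _ (by rw [map_add, map_add]; ring)
      map_smul' := fun a c => by
        have h1 := (t U).grToSheaf_mk_scalar_mul hA hU (algebraMap k _ a) (h U V W hU hV c)
        refine Eq.trans ?_ h1
        refine grToSheaf_congr hA _ ?_
        rw [map_smul, map_smul, AlgHom.commutes, ← smul_sub, Algebra.smul_def] }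
    (fun c c' => by
      -- With `s_U`, `s_V` the two sections, `s_U(cc') - s_V(cc') = s_U(c) (s_U(c') - s_V(c')) +
      -- s_V(c') (s_U(c) - s_V(c))`. On the quotient both `s_U(c)` and `s_V(c)` act as `c`, so this
      -- is the Leibniz rule.
      have h1 := (t U).grToSheaf_mk_scalar_mul hA hU c (h U V W hU hV c')
      have h2 := (t V).grToSheaf_mk_scalar_mul hA hV c' (h U V W hU hV c)
      refine Eq.trans ?_ (congrArg₂ (· + ·) h1 h2)
      refine Eq.trans ?_ (grToSheaf_mk_add hA _ _)
      refine grToSheaf_congr hA _ ?_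
      rw [map_mul, map_mul]
      ring)

lemma diffDer_apply (h : AgreeModPow t p) (U V : {U : T.Opens // U.1 ∈ 𝒰}) (W : T.Opens)
    (hU : W ≤ U.1) (hV : W ≤ V.1) (c : C.obj.obj (op W)) :
    diffDer hA h U V W hU hV c = grToSheaf hA p W (IdealGr.mk (h U V W hU hV c)) := rfl

/-- The cocycle of derivations given by sections `C → Z(A)` which agree modulo `I₀ ^ p`. -/
noncomputable def diffCocycle (h : AgreeModPow t p) (U V : {U : T.Opens // U.1 ∈ 𝒰}) :
    derSections (grSheaf hA p) (inter U.1 V.1) :=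
  ⟨fun W => diffDer hA h U V W.1 (W.2.trans (inter_le_left _ _)) (W.2.trans (inter_le_right _ _)),
    fun W W' hW c => by
      rw [diffDer_apply, diffDer_apply, modRes_grToSheaf]
      refine grToSheaf_congr hA _ ?_
      rw [map_sub, (t U).centerRes_scalar, (t V).centerRes_scalar]
      rfl⟩

/-- A section `C → Z(A)` over `U` can be changed by a derivation of `C` into
`I₀ ^ p / I₀ ^ (p + 1)`. -/
lemma exists_sub_scalar_eq [CharZero k] (hJ : IsNilpotent (RingHom.ker ε₀)) (hp : 1 ≤ p)
    {U : T.Opens} (t : DTrivialization ε₀ ε U) (s : derSections (grSheaf hA p) U) :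
    ∃ t' : DTrivialization ε₀ ε U, ∀ (W : T.Opens) (hU : W ≤ U) (c : C.obj.obj (op W)),
      ∃ ha : t.scalar hU c - t'.scalar hU c ∈ augIdeal ε (op W) ^ p,
        grToSheaf hA p W (IdealGr.mk ha) = s.1 ⟨W, hU⟩ c := by
  -- The splitting is `C`-linear, so composing `s` with it gives a derivation, now with values in `C
  -- ⊗ S_p` itself.
  let δ (V : {V : T.Opens // V ≤ U}) :
      Derivation k (C.obj.obj (op V.1)) (C.obj.obj (op V.1) ⊗[k] D) :=
    (t.grLift hA V.2).compDer (s.1 V)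
  have hδ V c : δ V c ∈ (centralPow ε₀ p).baseChange (C.obj.obj (op V.1)) :=
    t.grLift_mem hA V.2 _
  have hnat (V W : {V : T.Opens // V ≤ U}) (hW : W.1 ≤ V.1) (c : C.obj.obj (op V.1)) :
      δ W (commRes C hW c) = tensRes C D hW (δ V c) :=
    (congrArg (t.grLift hA W.2) (s.2 V W hW c)).trans (t.grLift_modRes hA V.2 hW _)
  refine ⟨t.compExp hJ hp δ hδ hnat, fun W hU c => ?_⟩
  -- Modulo `C ⊗ S_(p+1)` the old section minus the new one is `δ`, which identifies the class.
  -- Since `δ` lies in `C ⊗ S_p`, the difference itself lies in `I₀ ^ p`.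
  have h1 := neg_mem (t.τ_scalar_compExp hU hJ hp δ hδ hnat c)
  rw [neg_add, neg_sub, ← sub_eq_add_neg, ← DTrivialization.τ_sub] at h1
  have h2 := add_mem (Submodule.baseChange_le_baseChange (centralPow_anti p.le_succ) h1)
    (hδ ⟨W, hU⟩ c)
  rw [sub_add_cancel] at h2
  exact ⟨(t.mem_augIdeal_pow_iff hU).2 h2, t.grToSheaf_eq_of_grLift hA hU _ h1⟩

lemma exists_agreeModPow_succ [CharZero k] (hJ : IsNilpotent (RingHom.ker ε₀)) (hp : 1 ≤ p)
    (h𝒰 : T.IsCovOf T.whole 𝒰) [Subsingleton (Sheaf.H (derSheaf (grSheaf hA p)) 1)]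
    (h : AgreeModPow t p) : ∃ t' : ∀ U : {U : T.Opens // U.1 ∈ 𝒰}, DTrivialization ε₀ ε U.1,
      AgreeModPow t' (p + 1) := by
  obtain ⟨s, hs⟩ := exists_derivation_coboundary (grSheaf hA p) h𝒰 (diffCocycle hA h) (by
    intro U V U' W hU hV hU' c
    refine (grToSheaf_mk_add hA (h U V W hU hV c) (h V U' W hV hU' c)).symm.trans ?_
    exact grToSheaf_congr hA _ (sub_add_sub_cancel _ _ _))
  choose t' key using fun U => exists_sub_scalar_eq hA hJ hp (t U) (s U)
  refine ⟨t', fun U V W hU hV c => ?_⟩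
  obtain ⟨ha, ha'⟩ := key U W hU c
  obtain ⟨hb, hb'⟩ := key V W hV c
  have h3 := hs U V W hU hV c
  have h4 := ((t U).grToSheaf_eq_iff hA hU (h U V W hU hV c) (sub_mem ha hb)).1 (by
    refine h3.symm.trans ?_
    rw [← ha', ← hb']
    exact (map_sub (grToSheaf hA p W) (IdealGr.mk ha) (IdealGr.mk hb)).symm)
  -- With primes for the new sections, `(s_U - s_V) - ((s_U - s'_U) - (s_V - s'_V)) = s'_U - s'_V`.
  rwa [sub_sub_sub_comm, sub_sub_cancel, sub_sub_cancel] at h4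

lemma exists_agreeModPow [CharZero k] (hJ : IsNilpotent (RingHom.ker ε₀))
    (h𝒰 : T.IsCovOf T.whole 𝒰)
    (hH : ∀ p : ℕ, 1 ≤ p → Subsingleton (Sheaf.H (derSheaf (grSheaf hA p)) 1))
    (t : ∀ U : {U : T.Opens // U.1 ∈ 𝒰}, DTrivialization ε₀ ε U.1) (p : ℕ) (hp : 1 ≤ p) :
    ∃ t' : ∀ U : {U : T.Opens // U.1 ∈ 𝒰}, DTrivialization ε₀ ε U.1, AgreeModPow t' p := by
  induction p, hp using Nat.le_induction with
  | base => exact ⟨t, agreeModPow_one t⟩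
  | succ p hp ih =>
    obtain ⟨t', ht'⟩ := ih
    have := hH p hp
    exact exists_agreeModPow_succ hA hJ hp h𝒰 ht'

/-- Local sections `C → Z(A)` which agree on the intersections glue. -/
lemma exists_central_of_scalar_eq (h𝒰 : T.IsCovOf T.whole 𝒰)
    (t : ∀ U : {U : T.Opens // U.1 ∈ 𝒰}, DTrivialization ε₀ ε U.1)
    (ht : ∀ (U V : {U : T.Opens // U.1 ∈ 𝒰}) (W : T.Opens) (hU : W ≤ U.1) (hV : W ≤ V.1)
      (c : C.obj.obj (op W)), (t U).scalar hU c = (t V).scalar hV c) :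
    ∃ φ : C ⟶ centerSheaf A, φ ≫ centerAug ε = 𝟙 C := by
  have hZ : Presieve.IsSheaf T.site (centerPresheaf A ⋙ forget (CommAlgCat.{u} k)) :=
    (isSheaf_iff_isSheaf_of_type _ _).1 (Presheaf.isSheaf_comp_of_isSheaf T.site
      (centerPresheaf A) (forget (CommAlgCat.{u} k)) (isSheaf_centerPresheaf A))
  have hC : Presieve.IsSheaf T.site (C.obj ⋙ forget (CommAlgCat.{u} k)) :=
    (isSheaf_iff_isSheaf_of_type _ _).1 (Presheaf.isSheaf_comp_of_isSheaf T.site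
      C.obj (forget (CommAlgCat.{u} k)) C.property)
  have hext {V : T.Opens} {a b : centerSections A (op V)}
      (h : ∀ (U : T.Opens), U.1 ∈ 𝒰 → centerRes A (inter_le_left V U) a =
        centerRes A (inter_le_left V U) b) : a = b :=
    eq_of_resMap_cover hZ h𝒰 h
  -- The value of `φ` on `c` is glued from the scalar sections over `V ∩ U`. Multiplicativity,
  -- naturality and the augmentation are then checked on the covering.
  have key (V : T.Opens) (c : C.obj.obj (op V)) : ∃ a : centerSections A (op V),
      ∀ (U : T.Opens) (hU : U.1 ∈ 𝒰), centerRes A (inter_le_left V U) a =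
        (t ⟨U, hU⟩).scalar (inter_le_right V U) (commRes C (inter_le_left V U) c) := by
    refine exists_glue hZ h𝒰 V (fun U hU => (t ⟨U, hU⟩).scalar (inter_le_right V U)
      (commRes C (inter_le_left V U) c)) fun U U' hU hU' W hW hW' => ?_
    refine ((t ⟨U, hU⟩).centerRes_scalar _ hW _).trans
      (Eq.trans ?_ ((t ⟨U', hU'⟩).centerRes_scalar _ hW' _).symm)
    rw [commRes_commRes, commRes_commRes]
    exact ht _ _ _ _ _ _
  choose y hy using key
  let f (V : T.Opens) : C.obj.obj (op V) →ₐ[k] centerSections A (op V) :=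
    { toFun := y V
      map_one' := hext fun U hU => by rw [hy V _ U hU, map_one, map_one, map_one]
      map_mul' := fun c c' => hext fun U hU => by
        rw [map_mul, hy V _ U hU, hy V _ U hU, hy V _ U hU, map_mul, map_mul]
      map_zero' := hext fun U hU => by rw [hy V _ U hU, map_zero, map_zero, map_zero]
      map_add' := fun c c' => hext fun U hU => by
        rw [map_add, hy V _ U hU, hy V _ U hU, hy V _ U hU, map_add, map_add]
      commutes' := fun a => hext fun U hU => by
        rw [hy V _ U hU, AlgHom.commutes, AlgHom.commutes, AlgHom.commutes] }
  have hf (V W : T.Opens) (hW : W ≤ V) (c : C.obj.obj (op V)) :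
      y W (commRes C hW c) = centerRes A hW (y V c) := by
    refine hext fun U hU => ?_
    have hle : inter W U ≤ inter V U := le_inter ((inter_le_left _ _).trans hW) (inter_le_right _ _)
    have h1 : centerRes A (inter_le_left W U) (centerRes A hW (y V c)) =
        centerRes A hle (centerRes A (inter_le_left V U) (y V c)) :=
      (resMap_resMap (centerPresheaf A ⋙ forget _) _ _ _).trans
        (resMap_resMap (centerPresheaf A ⋙ forget _) _ _ _).symm
    rw [h1, hy V c U hU, (t ⟨U, hU⟩).centerRes_scalar, hy W _ U hU, commRes_commRes,
      commRes_commRes]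
  have haug (V : T.Opens) (c : C.obj.obj (op V)) : augVal ε V (y V c) = c := by
    refine eq_of_resMap_cover hC h𝒰 fun U hU => ?_
    have h1 : commRes C (inter_le_left V U) (augVal ε V (y V c)) =
        augVal ε (inter V U) (centerRes A (inter_le_left V U) (y V c)) :=
      congr(($((centerAug ε).hom.naturality (homOfLE (inter_le_left V U)).op)).hom (y V c)).symm
    rw [hy V c U hU] at h1
    exact h1.trans ((t ⟨U, hU⟩).centerAug_scalar _ _)
  refine ⟨⟨{ app := fun V => CommAlgCat.ofHom (f V.unop), naturality := fun V W g => ?_ }⟩, ?_⟩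
  · apply CommAlgCat.hom_ext
    ext c
    exact hf V.unop W.unop (leOfHom g.unop) c
  · ext V c
    exact haug V.unop c

end Glueing

/-! ### The theorem -/

theorem theoremT {X k D : Type u} [Field k] [CharZero k]
    [Ring D] [Algebra k D] [FiniteDimensional k D]
    (ε₀ : D →ₐ[k] k) (hJ : IsNilpotent (RingHom.ker ε₀))
    (T : GeneralizedTopology X)
    (C : Sheaf T.site (CommAlgCat.{u} k)) (hC : GeneralizedTopology.IsLocallyRinged C)
    (A : Sheaf T.site (AlgCat.{u} k)) (ε : A ⟶ algSheaf C) (hA : IsRingedDSpace ε₀ ε)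
    (hH : ∀ p : ℕ, 1 ≤ p → Subsingleton (Sheaf.H (derSheaf (grSheaf hA p)) 1)) :
    (∃ φ : C ⟶ centerSheaf A, φ ≫ centerAug ε = 𝟙 C) ∧
    ∀ φ : C ⟶ centerSheaf A, φ ≫ centerAug ε = 𝟙 C →
      ∃ E : BundleOfClass (moduleOfCentral φ) D,
        E.HasStructureGroup ε₀ ∧ E.IsCompatible ε₀ ε := by
  obtain ⟨𝒰, h𝒰, ht⟩ := hA
  let t (U : {U : T.Opens // U.1 ∈ 𝒰}) : DTrivialization ε₀ ε U.1 := (ht U.1 U.2).some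
  refine ⟨?_, fun φ hφ => ?_⟩
  · obtain ⟨N, hN⟩ := hJ
    -- The exponent is `N + 1` rather than `N` because the approximation starts at `p = 1`, while
    -- `N` could be zero.
    obtain ⟨t', ht'⟩ := exists_agreeModPow ⟨𝒰, h𝒰, ht⟩ ⟨N, hN⟩ h𝒰 hH t (N + 1) (by omega)
    refine exists_central_of_scalar_eq h𝒰 t' fun U V W hU hV c => ?_
    have h := ((t' U).mem_augIdeal_pow_iff hU).1 (ht' U V W hU hV c)
    have h0 : centralPow ε₀ (N + 1) = ⊥ :=
      eq_bot_iff.2 ((centralPow_anti N.le_succ).trans (centralPow_eq_bot hN).le)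
    rw [h0, Submodule.baseChange_bot, Submodule.mem_bot, DTrivialization.τ_sub, sub_eq_zero] at h
    exact Subtype.ext (((t' U).τ W hU).injective h)
  · refine ⟨⟨𝒰, h𝒰, fun U hU => (t ⟨U, hU⟩).moduleTrivialization hJ φ hφ⟩, ?_, ?_⟩
    · intro U U' hU hU' V hV hV'
      -- The transition function is the composite of the algebra isomorphisms `e.symm` and `e'`,
      -- each compatible with `ε`; its `C`-linearity is built into the module trivializations.
      let e := ((t ⟨U', hU'⟩).ofCentral hJ φ hφ).τ V hV'
      let e' := ((t ⟨U, hU⟩).ofCentral hJ φ hφ).τ V hV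
      refine ⟨map_one (e.symm.trans e'), map_mul (e.symm.trans e'), fun x => ?_⟩
      have h1 := ((t ⟨U', hU'⟩).ofCentral hJ φ hφ).aug V hV' (e.symm x)
      have h2 := ((t ⟨U, hU⟩).ofCentral hJ φ hφ).aug V hV (e.symm x)
      refine (h2.trans h1.symm).trans (congrArg _ (e.apply_symm_apply x))
    · intro U hU V hV
      exact ⟨map_mul (((t ⟨U, hU⟩).ofCentral hJ φ hφ).τ V hV),
        ((t ⟨U, hU⟩).ofCentral hJ φ hφ).aug V hV⟩
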